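/- Let $\mathcal P_c(\mathbb R^d)$ be the set of compactly supported Borel probability measures on $\mathbb R^d$ with the $1$-Wasserstein distance $W_1$. Let $V:\mathcal P_c(\mathbb R^d)\times\mathbb R\times\mathbb R^d\to\mathbb R^d$, written $V(t,\mu)(x)$, be $C^1$ in $(t,x)$ for every $\mu$, and assume that there are $L,K\in L^\infty_{loc}(\mathbb R)$ such that for a.e. $t$ and all $\mu,\nu,x,y$ $$|V(t,\mu)(x)-V(t,\mu)(y)|\le L(t)|x-y|,\qquad |V(t,\mu)(x)-V(t,\nu)(x)|\le K(t)\,W_1(\mu,\nu).$$ Let $T\ge 0$. Then: 1. For every $\mu_0\in\mathcal P_c(\mathbb R^d)$ the Cauchy problem $\partial_t\mu_t+\mathrm{div}(V(t,\mu_t)\mu_t)=0$, $\mu_t|_{t=0}=\mu_0$ has exactly one distributional solution on $[0,T]$ that is a $W_1$-continuous curve in $\mathcal P_c(\mathbb R^d)$; for every $x\in\mathbb R^d$ the problem $\partial_tG_t(\mu_0,x)=V(t,\mu_t)(G_t(\mu_0,x))$, $G_0(\mu_0,x)=x$ has exactly one solution on $[0,T]$. Put $f_T(\mu_0)=\mu_T$.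 2. For a set $\Omega\subset\mathbb R^d$ let $\mathcal M^+(\Omega)$ be the set of measures $s\mu$ with $s>0$ and $\mu$ a Borel probability measure on $\Omega$, and, for bounded $\Omega$, let $W_1(s_1\mu_1,s_2\mu_2)=W_1(\mu_1,\mu_2)+|s_1-s_2|$. Extend the maps by $f_T(s\mu)=s f_T(\mu)$ and $G_T(s\mu,x)=G_T(\mu,x)$. There is a constant $C$ such that for every compact $\Omega\subset\mathbb R^d$ the following hold for $f_T:\mathcal M^+(\Omega)\to\mathcal M^+(\mathbb R^d)$. * $f_T(\mu)=G_T(\mu,\cdot)_\#\mu$ for all $\mu\in\mathcal M^+(\Omega)$, and $|G_T(\mu,x)-G_T(\nu,y)|\le C\,(W_1(\mu,\nu)+|x-y|)$ for all $\mu,\nu\in\mathcal M^+(\Omega)$, $x,y\in\Omega$. * (B1) $f_T$ is support preserving: for all $n\ge1$, $c>0$ and $x_1,\dots,x_n\in\Omega$ there are $y_1,\dots,y_n\in\mathbb R^d$ with $f_T(\sum_i\frac cn\delta_{x_i})=\sum_i\frac cn\delta_{y_i}$ and $y_i=y_j$ whenever $x_i=x_j$. * (B2) For all $\rho,\eta>0$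 let $\mathcal X$ be the set of triplets $(\mu,x,\psi)$ with $\mu\in\mathcal M^+(\Omega)$, $\mu(\Omega)\le\rho$, $x\in\Omega$, and $\psi\in C^1_0(\mathbb R^d)$ (the $C^1$ functions that vanish at infinity) with $\mathrm{Lip}(\psi)\le\eta$, with the distance $D_{\mathcal X}=W_1(\mu_1,\mu_2)+|x_1-x_2|+\|\psi_1-\psi_2\|_{L^\infty}$. For every $(\mu,x,\psi)\in\mathcal X$ the regular part of the derivative $$\overline{\mathcal D}_{f_T}(\mu,x,\psi)=\lim_{k\to\infty}\lim_{\epsilon\to0+}\frac{\langle\psi_k,f_T(\mu_k+\epsilon\delta_x)-f_T(\mu_k)\rangle}{\epsilon}$$ exists, that is: there are sequences $\mu_k\in\mathcal M^+(\Omega)$, $\psi_k\in C^1_0(\mathbb R^d)$ with $\psi_k$ locally constant in an open neighbourhood of $\mathrm{supp}\, f_T(\mu_k)$, $W_1(\mu_k,\mu)\to0$, $\|\psi_k-\psi\|_{L^\infty}\to0$, and for all such sequences the limits exist and have the same value. Moreover $\overline{\mathcal D}_{f_T}:\mathcal X\to\mathbb R$ is uniformly continuous with respect to $D_{\mathcal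 X}$. -/

import Mathlib

open MeasureTheory Set Filter Topology
open scoped NNReal ENNReal ContDiff ZeroAtInfty

noncomputable section

/-- `ℝ^d` with its Euclidean norm. -/
abbrev Eucl (d : ℕ) : Type := EuclideanSpace ℝ (Fin d)

/-! ### Spaces of measures and the Wasserstein distance -/

/-- Compactly supported Borel probability measures on `ℝ^d`. -/
def ProbCpt (d : ℕ) : Type :=
  {μ : ProbabilityMeasure (Eucl d) //
    ∃ K : Set (Eucl d), IsCompact K ∧ (μ : Measure (Eucl d)) Kᶜ = 0}

/-- The underlying measure. -/
def ProbCpt.toMeasure {d : ℕ} (μ : ProbCpt d) : Measure (Eucl d) := (μ.1 : Measure (Eucl d))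

/-- The Dirac measure `δ_x`. -/
def pointMass {d : ℕ} (x : Eucl d) : FiniteMeasure (Eucl d) :=
  ⟨Measure.dirac x, inferInstance⟩

/-- Nonzero finite Borel measures on the Borel set `Ω ⊆ ℝ^d`, regarded as measures on `ℝ^d`
that do not charge the complement of `Ω`. -/
def PosMeas {d : ℕ} (Ω : Set (Eucl d)) : Type :=
  {μ : FiniteMeasure (Eucl d) // μ ≠ 0 ∧ (μ : Measure (Eucl d)) Ωᶜ = 0}

namespace PosMeas

variable {d : ℕ} {Ω : Set (Eucl d)}

/-- The underlying measure. -/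
def toMeasure (μ : PosMeas Ω) : Measure (Eucl d) := (μ.1 : Measure (Eucl d))

/-- The total mass `s` of `μ = s ν`, with `ν` a probability measure. -/
def mass (μ : PosMeas Ω) : ℝ≥0 := μ.1.mass

/-- The probability measure `ν` with `μ = s ν`, where `s` is the total mass of `μ`. -/
def normalize (μ : PosMeas Ω) : ProbabilityMeasure (Eucl d) := μ.1.normalize

theorem normalize_compl (μ : PosMeas Ω) : (μ.normalize : Measure (Eucl d)) Ωᶜ = 0 := by
  have h := μ.1.toMeasure_normalize_eq_of_nonzero μ.2.1
  unfold normalize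
  rw [h, Measure.smul_apply, μ.2.2, smul_zero]

/-- For compact `Ω`, the normalized measure as a compactly supported probability measure. -/
def toProbCpt (hΩ : IsCompact Ω) (μ : PosMeas Ω) : ProbCpt d :=
  ⟨μ.normalize, Ω, hΩ, μ.normalize_compl⟩

theorem add_smul_dirac_mem (hΩ : MeasurableSet Ω) (μ : PosMeas Ω) (x : Ω) (ε : ℝ≥0) :
    μ.1 + ε • pointMass (x : Eucl d) ≠ 0 ∧
    ((μ.1 + ε • pointMass (x : Eucl d) :
      FiniteMeasure (Eucl d)) : Measure (Eucl d)) Ωᶜ = 0 := by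
  constructor
  · intro h
    have h1 := congrArg (fun ν : FiniteMeasure (Eucl d) => ν univ) h
    rw [FiniteMeasure.coeFn_add, Pi.add_apply, FiniteMeasure.coeFn_zero, Pi.zero_apply] at h1
    exact μ.2.1 ((FiniteMeasure.mass_zero_iff _).1 (add_eq_zero.1 h1).1)
  · rw [FiniteMeasure.toMeasure_add, FiniteMeasure.toMeasure_smul, Measure.add_apply, μ.2.2,
      Measure.smul_apply]
    have : (Measure.dirac (x : Eucl d)) Ωᶜ = 0 := by
      rw [Measure.dirac_apply' _ hΩ.compl]
      simp
    change 0 + ε • (Measure.dirac (x : Eucl d)) Ωᶜ = 0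
    rw [this, smul_zero, add_zero]

/-- The measure `μ + ε δ_x`, for a point `x` of `Ω`. -/
def addDirac (hΩ : MeasurableSet Ω) (μ : PosMeas Ω) (x : Ω) (ε : ℝ≥0) : PosMeas Ω :=
  ⟨μ.1 + ε • pointMass (x : Eucl d),
    add_smul_dirac_mem hΩ μ x ε⟩

end PosMeas

instance (d : ℕ) : Nonempty (ProbCpt d) :=
  ⟨⟨⟨Measure.dirac 0, inferInstance⟩, {0}, isCompact_singleton, by
    simp [ProbabilityMeasure.toMeasure]⟩⟩

/-- The 1-Wasserstein distance of two measures: the infimum of `∫ |x - y| dπ(x,y)` over all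
couplings `π`, as an extended nonnegative number. -/
def wass {d : ℕ} (μ ν : Measure (Eucl d)) : ℝ≥0∞ :=
  ⨅ (π : Measure (Eucl d × Eucl d)) (_ : π.map Prod.fst = μ) (_ : π.map Prod.snd = ν),
    ∫⁻ p, edist p.1 p.2 ∂π

/-- The 1-Wasserstein distance of compactly supported probability measures (a finite number). -/
def ProbCpt.W1 {d : ℕ} (μ ν : ProbCpt d) : ℝ := (wass μ.toMeasure ν.toMeasure).toReal

/-- The extension `W₁(s₁ μ₁, s₂ μ₂) = W₁(μ₁, μ₂) + |s₁ - s₂|` of the 1-Wasserstein distance to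
nonzero finite measures on a bounded set. -/
def PosMeas.W1 {d : ℕ} {Ω : Set (Eucl d)} (μ ν : PosMeas Ω) : ℝ :=
  (wass (μ.normalize : Measure (Eucl d)) (ν.normalize : Measure (Eucl d))).toReal
    + |(μ.mass : ℝ) - (ν.mass : ℝ)|

/-! ### Support-preserving maps, in-context maps, regular part of the derivative -/

section Maps

variable {d d' : ℕ} {Ω : Set (Eucl d)}

/-- Condition (B1): for all `x₁, …, xₙ ∈ Ω` and `c > 0`, the measure `f (∑ (c/n) δ_{x_i})` is
`∑ (c/n) δ_{y_i}` for some `y₁, …, yₙ` such that `x_i = x_j` implies `y_i = y_j`. -/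
def SupportPreserving (f : PosMeas Ω → PosMeas (univ : Set (Eucl d'))) : Prop :=
  ∀ (n : ℕ) (c : ℝ≥0) (x : Fin n → Eucl d) (μ : PosMeas Ω), 0 < n → 0 < c → (∀ i, x i ∈ Ω) →
    μ.toMeasure = ∑ i, (c / (n : ℝ≥0)) • Measure.dirac (x i) →
    ∃ y : Fin n → Eucl d', (∀ i j, x i = x j → y i = y j) ∧
      (f μ).toMeasure = ∑ i, (c / (n : ℝ≥0)) • Measure.dirac (y i)

/-- `f` is given by the in-context map `G`, that is `f μ = G(μ)_# μ`. (The values of `G μ` off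
`Ω` do not matter, since `μ` does not charge the complement of `Ω`.) -/
def IsGivenByInContext (f : PosMeas Ω → PosMeas (univ : Set (Eucl d')))
    (G : PosMeas Ω → Eucl d → Eucl d') : Prop :=
  ∀ μ : PosMeas Ω, AEMeasurable (G μ) μ.toMeasure ∧
    (f μ).toMeasure = μ.toMeasure.map (G μ)

/-- `ψ` is (locally) constant in an open neighbourhood of the support of `ν`. -/
def LocConstNearSupport (ψ : Eucl d' → ℝ) (ν : Measure (Eucl d')) : Prop :=
  ∀ y ∈ ν.support, ∀ᶠ z in 𝓝 y, ψ z = ψ y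

/-- The approximating sequences `(μ_k, ψ_k)` of `(μ, ψ)` that are used to define the regular part
of the derivative of `f`. -/
structure IsAdmissible (f : PosMeas Ω → PosMeas (univ : Set (Eucl d')))
    (μ : PosMeas Ω) (ψ : C₀(Eucl d', ℝ))
    (μs : ℕ → PosMeas Ω) (ψs : ℕ → C₀(Eucl d', ℝ)) : Prop where
  contDiff : ∀ k, ContDiff ℝ 1 (ψs k)
  locConst : ∀ k, LocConstNearSupport (ψs k) (f (μs k)).toMeasure
  tendsto_measure : Tendsto (fun k => (μs k).W1 μ) atTop (𝓝 0)
  tendsto_fun : Tendsto (fun k => dist (ψs k) ψ) atTop (𝓝 0)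

/-- The difference quotient `⟨ψ, f(μ + ε δ_x) - f(μ)⟩ / ε`. -/
def diffQuot (hΩ : MeasurableSet Ω) (f : PosMeas Ω → PosMeas (univ : Set (Eucl d')))
    (μ : PosMeas Ω) (x : Ω) (ψ : C₀(Eucl d', ℝ)) (ε : ℝ≥0) : ℝ :=
  (∫ y, ψ y ∂(f (μ.addDirac hΩ x ε)).toMeasure - ∫ y, ψ y ∂(f μ).toMeasure) / (ε : ℝ)

/-- The regular part of the derivative of `f` exists at `(μ, x, ψ)` and equals `D`: admissible
sequences exist, and along all of them the iterated limit
`lim_{k → ∞} lim_{ε → 0+} ⟨ψ_k, f(μ_k + ε δ_x) - f(μ_k)⟩ / ε` exists and equals `D`. -/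
def HasRegularPart (hΩ : MeasurableSet Ω) (f : PosMeas Ω → PosMeas (univ : Set (Eucl d')))
    (μ : PosMeas Ω) (x : Ω) (ψ : C₀(Eucl d', ℝ)) (D : ℝ) : Prop :=
  (∃ μs ψs, IsAdmissible f μ ψ μs ψs) ∧
  ∀ μs ψs, IsAdmissible f μ ψ μs ψs →
    ∃ l : ℕ → ℝ,
      (∀ k, Tendsto (fun ε : ℝ≥0 => diffQuot hΩ f (μs k) x (ψs k) ε) (𝓝[>] 0) (𝓝 (l k))) ∧
      Tendsto l atTop (𝓝 D)

/-- The space `𝒳` of triplets `(μ, x, ψ)` with `μ(Ω) ≤ ρ`, `x ∈ Ω`, and `ψ` a `C¹` function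
vanishing at infinity with Lipschitz constant at most `η`. -/
structure Triplet (Ω : Set (Eucl d)) (d' : ℕ) (ρ η : ℝ≥0) where
  μ : PosMeas Ω
  x : Ω
  ψ : C₀(Eucl d', ℝ)
  mass_le : μ.mass ≤ ρ
  contDiff : ContDiff ℝ 1 ψ
  lipschitz : LipschitzWith η ψ

/-- The distance `W₁(μ₁, μ₂) + |x₁ - x₂| + ‖ψ₁ - ψ₂‖_∞` on `𝒳`. -/
def Triplet.D {ρ η : ℝ≥0} (p q : Triplet Ω d' ρ η) : ℝ :=
  p.μ.W1 q.μ + dist p.x q.x + dist p.ψ q.ψ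

/-- Condition (B2): the regular part of the derivative of `f` exists at all points of `𝒳` and is
uniformly continuous on `𝒳`. -/
def UniformRegularPart (hΩ : MeasurableSet Ω)
    (f : PosMeas Ω → PosMeas (univ : Set (Eucl d'))) (ρ η : ℝ≥0) : Prop :=
  ∃ Df : Triplet Ω d' ρ η → ℝ,
    (∀ p, HasRegularPart hΩ f p.μ p.x p.ψ (Df p)) ∧
    ∀ ε > 0, ∃ δ > 0, ∀ p q : Triplet Ω d' ρ η, p.D q < δ → |Df p - Df q| < ε

theorem homExtend_mem (s : ℝ≥0) (hs : s ≠ 0) (ν : ProbCpt d') :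
    s • ν.1.toFiniteMeasure ≠ 0 ∧
    ((s • ν.1.toFiniteMeasure : FiniteMeasure (Eucl d')) : Measure (Eucl d'))
      (univ : Set (Eucl d'))ᶜ = 0 := by
  refine ⟨fun h => ?_, by simp⟩
  have h1 := congrArg (fun ν : FiniteMeasure (Eucl d') => ν univ) h
  rw [FiniteMeasure.coeFn_smul, Pi.smul_apply, FiniteMeasure.coeFn_zero, Pi.zero_apply,
    smul_eq_mul] at h1
  have h2 : (ν.1.toFiniteMeasure) univ = 1 := ProbabilityMeasure.mass_toFiniteMeasure ν.1
  rw [h2, mul_one] at h1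
  exact hs h1

/-- The extension `f(s μ) = s f(μ)` to nonzero finite measures on the compact set `Ω` of a map
`f` that is defined on probability measures. -/
def homExtend (hΩ : IsCompact Ω) (f : ProbCpt d → ProbCpt d') :
    PosMeas Ω → PosMeas (univ : Set (Eucl d')) := fun μ =>
  ⟨μ.mass • (f (μ.toProbCpt hΩ)).1.toFiniteMeasure,
    homExtend_mem μ.mass (fun h => μ.2.1 ((FiniteMeasure.mass_zero_iff _).1 h)) _⟩

end Maps

/-! ### The nonlocal transport equation -/

section Vlasov

variable {d : ℕ}

/-- A function in `L^∞_loc(ℝ)`. -/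
def LocBounded (K : ℝ → ℝ) : Prop :=
  ∀ a b : ℝ, MemLp K ∞ (volume.restrict (Icc a b))

/-- The assumptions on a velocity field `V : μ ↦ V[μ](t, x)`: for every `μ` the field is `C¹` in
`(t, x)`; it is Lipschitz in `x` and in `μ` with constants `L(t)` and `K(t)` that are locally
bounded in time. -/
structure IsVelocityField (V : ProbCpt d → ℝ → Eucl d → Eucl d) : Prop where
  contDiff : ∀ μ, ContDiff ℝ 1 (fun p : ℝ × Eucl d => V μ p.1 p.2)
  lipschitz_space : ∃ L : ℝ → ℝ, LocBounded L ∧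
    ∀ᵐ t : ℝ, ∀ μ x y, ‖V μ t x - V μ t y‖ ≤ L t * ‖x - y‖
  lipschitz_measure : ∃ K : ℝ → ℝ, LocBounded K ∧
    ∀ᵐ t : ℝ, ∀ μ ν x, ‖V μ t x - V ν t x‖ ≤ K t * μ.W1 ν

/-- `μ` is a solution on `[0, T]` of `∂_t μ_t + div (V(t, μ_t) μ_t) = 0`, `μ_{t=0} = μ₀`: it is
continuous for the distance `W₁`, and the equation holds in the sense of distributions (tested
with functions of `x`, the time derivative being written in integrated form). -/
structure IsVlasovSolution (V : ProbCpt d → ℝ → Eucl d → Eucl d) (T : ℝ) (μ₀ : ProbCpt d)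
    (μ : ℝ → ProbCpt d) : Prop where
  initial : μ 0 = μ₀
  continuous : ∀ t ∈ Icc 0 T, Tendsto (fun s => (μ s).W1 (μ t)) (𝓝[Icc 0 T] t) (𝓝 0)
  intervalIntegrable : ∀ φ : Eucl d → ℝ, ContDiff ℝ ∞ φ → HasCompactSupport φ →
    IntervalIntegrable (fun s => ∫ x, fderiv ℝ φ x (V (μ s) s x) ∂(μ s).toMeasure) volume 0 T
  weak : ∀ φ : Eucl d → ℝ, ContDiff ℝ ∞ φ → HasCompactSupport φ → ∀ t ∈ Icc 0 T,
    ∫ x, φ x ∂(μ t).toMeasure = ∫ x, φ x ∂μ₀.toMeasure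
      + ∫ s in (0 : ℝ)..t, ∫ x, fderiv ℝ φ x (V (μ s) s x) ∂(μ s).toMeasure

/-- The solution on `[0, T]` with initial value `μ₀` (an arbitrary curve if there is none). -/
def vlasovSolution (V : ProbCpt d → ℝ → Eucl d → Eucl d) (T : ℝ) (μ₀ : ProbCpt d) :
    ℝ → ProbCpt d :=
  Classical.epsilon (IsVlasovSolution V T μ₀)

/-- The solution map `f_T : μ₀ ↦ μ_T`. -/
def solutionMap (V : ProbCpt d → ℝ → Eucl d → Eucl d) (T : ℝ) (μ₀ : ProbCpt d) : ProbCpt d :=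
  vlasovSolution V T μ₀ T

/-- `γ` solves `γ'(t) = V(t, μ_t)(γ(t))` on `[0, T]`, `γ(0) = x`, along the solution `μ_t` with
initial value `μ₀`. -/
structure IsCharacteristic (V : ProbCpt d → ℝ → Eucl d → Eucl d) (T : ℝ) (μ₀ : ProbCpt d)
    (x : Eucl d) (γ : ℝ → Eucl d) : Prop where
  initial : γ 0 = x
  ode : ∀ t ∈ Icc 0 T,
    HasDerivWithinAt γ (V (vlasovSolution V T μ₀ t) t (γ t)) (Icc 0 T) t

/-- The flow map `G_T(μ₀, x)`: the value at time `T` of the characteristic that starts at `x`. -/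
def flowMap (V : ProbCpt d → ℝ → Eucl d → Eucl d) (T : ℝ) (μ₀ : ProbCpt d) (x : Eucl d) :
    Eucl d :=
  Classical.epsilon (IsCharacteristic V T μ₀ x) T

end Vlasov

end

/-!
The nonlocal transport equation is solved in Lagrangian form. Let `S` be a compact set carrying the
initial measure, and `P` the initial measure on `S`. A curve `Y` in the Banach space `C(S, ℝ^d)` is
a flow along its own law `Y_# P` if `Y' = V(t, Y_# P)(Y)`; since `W₁(Y_# P, Z_# P) ≤ ‖Y - Z‖`, the
right-hand side is Lipschitz in `Y` (`IsUniformField.lipschitzWith_selfConsistent`), so that this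
equation has exactly one solution on `[0, T]`, and the push-forward of `P` by it is a distributional
solution (`isContinuitySolution_pushCpt`).

Conversely, let `μ` be any distributional solution that is continuous for `W₁`. The field
`b(t, x) = V(t, μ_t)(x)` is continuous, and Lipschitz in `x`. By uniqueness for the linear
continuity equation (`IsContinuitySolution.eqOn`), `μ` is the push-forward of `P` by the flow of `b`, which is
therefore a flow along its own law, and hence unique. Uniqueness for the linear equation is proved
by duality. A test function at a time `τ` is transported back to time `0` by the explicit Euler
scheme `u ↦ u ∘ (id + h b_t)`, and the resulting Lipschitz functions are mollified at a scale `δ`.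
As `b` is Lipschitz, mollification commutes with a step of the scheme up to `O(h δ)`, and the error
of a step along a solution is `o(h)` for fixed `δ`; so the integral of the test function at time `τ`
is determined by the initial measure, on letting `h → 0` and then `δ → 0`.

For the stability estimate, let `Θ` be the supremum of `e^{-λ t} W₁(μ_t, ν_t)` with `λ` large. The
characteristics from `x` and `y` are at distance at most `e^{λ t} (|x - y| + Θ / 2)`. Integrating
this over a nearly optimal coupling of the initial measures gives `Θ ≤ W₁(μ_0, ν_0) + Θ / 2`, which
bounds `Θ`, and with it the distance of the characteristics (`IsUniformField.norm_flowMap_sub_le`).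

With `f(μ) = G(μ, ·)_# μ`, the quotient `⟨ψ, f(μ + ε δ_x) - f(μ)⟩ / ε` is the sum of
`ψ(G(μ + ε δ_x, x))` and of the contribution of the displacement of the mass of `μ`. The latter
vanishes for small `ε` if `ψ` is locally constant near the support of `f(μ)`. The regular part of
the derivative is therefore `ψ(G(μ, x))`, which is Lipschitz in `(μ, x, ψ)`.
-/

noncomputable section

/-! ### The Wasserstein distance -/

theorem wass_le_lintegral_coupling {d : ℕ} (π : Measure (Eucl d × Eucl d)) :
    wass (π.map Prod.fst) (π.map Prod.snd) ≤ ∫⁻ p, edist p.1 p.2 ∂π :=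
  iInf_le_of_le π (iInf_le_of_le rfl (iInf_le_of_le rfl le_rfl))

theorem wass_map_le {d : ℕ} {X : Type*} [MeasurableSpace X] (P : Measure X) {f g : X → Eucl d}
    (hf : Measurable f) (hg : Measurable g) :
    wass (P.map f) (P.map g) ≤ ∫⁻ x, edist (f x) (g x) ∂P := by
  have h := wass_le_lintegral_coupling (P.map fun x => (f x, g x))
  rw [Measure.map_map measurable_fst (hf.prodMk hg), Measure.map_map measurable_snd (hf.prodMk hg),
    lintegral_map (by fun_prop) (hf.prodMk hg)] at h
  exact h

theorem exists_coupling_lt {d : ℕ} {μ ν : Measure (Eucl d)} {c : ℝ≥0∞} (h : wass μ ν < c) :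
    ∃ π : Measure (Eucl d × Eucl d), π.map Prod.fst = μ ∧ π.map Prod.snd = ν ∧
      ∫⁻ p, edist p.1 p.2 ∂π < c := by
  unfold wass at h
  obtain ⟨π, h⟩ := iInf_lt_iff.1 h
  obtain ⟨h1, h⟩ := iInf_lt_iff.1 h
  obtain ⟨h2, h⟩ := iInf_lt_iff.1 h
  exact ⟨π, h1, h2, h⟩

theorem ae_coupling_mem {d : ℕ} {μ ν : Measure (Eucl d)} {K K' : Set (Eucl d)}
    (hK : MeasurableSet K) (hK' : MeasurableSet K') (hμ : μ Kᶜ = 0) (hν : ν K'ᶜ = 0)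
    {π : Measure (Eucl d × Eucl d)} (h1 : π.map Prod.fst = μ) (h2 : π.map Prod.snd = ν) :
    ∀ᵐ p ∂π, p.1 ∈ K ∧ p.2 ∈ K' := by
  rw [← h1, Measure.map_apply measurable_fst hK.compl] at hμ
  rw [← h2, Measure.map_apply measurable_snd hK'.compl] at hν
  exact (show ∀ᵐ p ∂π, p.1 ∈ K from hμ).and (show ∀ᵐ p ∂π, p.2 ∈ K' from hν)

theorem wass_ne_top {d : ℕ} {μ ν : Measure (Eucl d)} [IsProbabilityMeasure μ]
    [IsProbabilityMeasure ν] {K K' : Set (Eucl d)} (hK : IsCompact K) (hK' : IsCompact K')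
    (hμ : μ Kᶜ = 0) (hν : ν K'ᶜ = 0) : wass μ ν ≠ ⊤ := by
  have hb : Bornology.IsBounded (K ∪ K') := (hK.union hK').isBounded
  have h1 : (μ.prod ν).map Prod.fst = μ := by simp
  have h2 : (μ.prod ν).map Prod.snd = ν := by simp
  have hle := wass_le_lintegral_coupling (μ.prod ν)
  rw [h1, h2] at hle
  have : ∫⁻ p, edist p.1 p.2 ∂(μ.prod ν) ≤ ∫⁻ _, Metric.ediam (K ∪ K') ∂(μ.prod ν) := by
    refine lintegral_mono_ae ?_
    filter_upwards [ae_coupling_mem hK.measurableSet hK'.measurableSet hμ hν h1 h2] with p hp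
    exact Metric.edist_le_ediam_of_mem (Or.inl hp.1) (Or.inr hp.2)
  refine ne_top_of_le_ne_top ?_ (hle.trans this)
  simpa using hb.ediam_ne_top

namespace ProbCpt

variable {d : ℕ}

instance (μ : ProbCpt d) : IsProbabilityMeasure μ.toMeasure := by
  unfold toMeasure; infer_instance

theorem toMeasure_injective : Function.Injective (toMeasure (d := d)) := fun _ _ h =>
  Subtype.ext (Subtype.ext h)

theorem wass_ne_top (μ ν : ProbCpt d) : wass μ.toMeasure ν.toMeasure ≠ ⊤ := by
  obtain ⟨K, hK, hμ⟩ := μ.2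
  obtain ⟨K', hK', hν⟩ := ν.2
  exact _root_.wass_ne_top hK hK' hμ hν

theorem W1_nonneg (μ ν : ProbCpt d) : 0 ≤ μ.W1 ν := ENNReal.toReal_nonneg

theorem ofReal_W1 (μ ν : ProbCpt d) :
    ENNReal.ofReal (μ.W1 ν) = wass μ.toMeasure ν.toMeasure :=
  ENNReal.ofReal_toReal (wass_ne_top μ ν)

theorem exists_coupling (μ ν : ProbCpt d) {ε : ℝ} (hε : 0 < ε) :
    ∃ π : Measure (Eucl d × Eucl d), π.map Prod.fst = μ.toMeasure ∧
      π.map Prod.snd = ν.toMeasure ∧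
      ∫⁻ p, edist p.1 p.2 ∂π < ENNReal.ofReal (μ.W1 ν + ε) := by
  refine exists_coupling_lt ?_
  rw [← ofReal_W1]
  exact (ENNReal.ofReal_lt_ofReal_iff (by linarith [W1_nonneg μ ν])).2 (by linarith)

theorem integrable_of_continuous (μ : ProbCpt d) {F : Type*} [NormedAddCommGroup F]
    {g : Eucl d → F} (hg : Continuous g) : Integrable g μ.toMeasure := by
  obtain ⟨K, hK, hμ⟩ := μ.2
  have h : IntegrableOn g K μ.toMeasure := hg.continuousOn.integrableOn_compact hK
  rwa [IntegrableOn, Measure.restrict_eq_self_of_ae_mem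
    (show ∀ᵐ x ∂μ.toMeasure, x ∈ K from hμ)] at h

/-- The easy half of Kantorovich duality. -/
theorem abs_integral_sub_le (μ ν : ProbCpt d) {Λ : ℝ≥0} {g : Eucl d → ℝ}
    (hg : LipschitzWith Λ g) :
    |∫ x, g x ∂μ.toMeasure - ∫ x, g x ∂ν.toMeasure| ≤ Λ * μ.W1 ν := by
  refine le_of_forall_pos_le_add fun ε hε => ?_
  have hε' : 0 < ε / (Λ + 1) := by positivity
  obtain ⟨π, h1, h2, h3⟩ := exists_coupling μ ν hε'
  have i1 : Integrable (fun p : Eucl d × Eucl d => g p.1) π := by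
    have := integrable_of_continuous μ hg.continuous
    rw [← h1] at this
    exact this.comp_measurable measurable_fst
  have i2 : Integrable (fun p : Eucl d × Eucl d => g p.2) π := by
    have := integrable_of_continuous ν hg.continuous
    rw [← h2] at this
    exact this.comp_measurable measurable_snd
  have e1 : ∫ x, g x ∂μ.toMeasure = ∫ p, g p.1 ∂π := by
    rw [← h1, integral_map (by fun_prop) hg.continuous.aestronglyMeasurable]
  have e2 : ∫ x, g x ∂ν.toMeasure = ∫ p, g p.2 ∂π := by
    rw [← h2, integral_map (by fun_prop) hg.continuous.aestronglyMeasurable]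
  rw [e1, e2, ← integral_sub i1 i2]
  have h4 : ENNReal.ofReal |∫ p, (g p.1 - g p.2) ∂π|
      ≤ ENNReal.ofReal (Λ * (μ.W1 ν + ε / (Λ + 1))) := by
    calc ENNReal.ofReal |∫ p, (g p.1 - g p.2) ∂π|
        = ‖∫ p, (g p.1 - g p.2) ∂π‖ₑ := by rw [← Real.norm_eq_abs, ofReal_norm]
      _ ≤ ∫⁻ p, ‖g p.1 - g p.2‖ₑ ∂π := enorm_integral_le_lintegral_enorm _
      _ ≤ ∫⁻ p, Λ * edist p.1 p.2 ∂π := by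
          refine lintegral_mono fun p => ?_
          rw [← edist_eq_enorm_sub]
          exact hg p.1 p.2
      _ = Λ * ∫⁻ p, edist p.1 p.2 ∂π := lintegral_const_mul _ (by fun_prop)
      _ ≤ Λ * ENNReal.ofReal (μ.W1 ν + ε / (Λ + 1)) := by gcongr
      _ = _ := by rw [ENNReal.ofReal_mul (NNReal.coe_nonneg Λ), ENNReal.ofReal_coe_nnreal]
  have h5 := (ENNReal.ofReal_le_ofReal_iff
    (mul_nonneg Λ.2 (by linarith [W1_nonneg μ ν]))).1 h4
  refine h5.trans ?_
  have h6 : (Λ : ℝ) * (ε / (Λ + 1)) ≤ ε := by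
    rw [mul_div_assoc', div_le_iff₀ (by positivity)]
    nlinarith
  rw [mul_add]
  exact add_le_add le_rfl h6

end ProbCpt

/-! ### Global solutions of Lipschitz differential equations -/

section ODE

variable {E : Type*} [NormedAddCommGroup E] [NormedSpace ℝ E]

theorem HasDerivWithinAt.glue {α β f : ℝ → E} {a b c : ℝ} (hab : a ≤ b) (hbc : b ≤ c)
    (h : α b = β b) (hα : ∀ t ∈ Icc a b, HasDerivWithinAt α (f t) (Icc a b) t)
    (hβ : ∀ t ∈ Icc b c, HasDerivWithinAt β (f t) (Icc b c) t) :
    ∀ t ∈ Icc a c, HasDerivWithinAt (fun s => if s ≤ b then α s else β s) (f t) (Icc a c) t := by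
  intro t ht
  set γ : ℝ → E := fun s => if s ≤ b then α s else β s with hγ
  have e1 : ∀ s ∈ Icc a b, γ s = α s := fun s hs => by simp [hγ, hs.2]
  have e2 : ∀ s ∈ Icc b c, γ s = β s := fun s hs => by
    by_cases hsb : s ≤ b
    · have : s = b := le_antisymm hsb hs.1
      simp [hγ, this, h]
    · simp [hγ, hsb]
  rw [← Icc_union_Icc_eq_Icc hab hbc]
  refine HasDerivWithinAt.union ?_ ?_
  · by_cases h' : t ≤ b
    · exact (hα t ⟨ht.1, h'⟩).congr e1 (e1 t ⟨ht.1, h'⟩)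
    · exact HasFDerivWithinAt.of_notMem_closure (by rw [closure_Icc]; exact fun h => h' h.2)
  · by_cases h' : b ≤ t
    · exact (hβ t ⟨h', ht.2⟩).congr e2 (e2 t ⟨h', ht.2⟩)
    · exact HasFDerivWithinAt.of_notMem_closure (by rw [closure_Icc]; exact fun h => h' h.1)

/-- For a globally Lipschitz field the length of the interval of existence in the
Picard-Lindelöf theorem does not depend on the initial condition. -/
theorem exists_solution_of_lipschitz_short [CompleteSpace E] {f : ℝ → E → E} {K : ℝ≥0}
    (hf : ∀ t, LipschitzWith K (f t)) (hc : ∀ x, Continuous (f · x)) (a : ℝ) (x : E) :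
    ∃ α : ℝ → E, α a = x ∧ ∀ t ∈ Icc a (a + 1 / (2 * (K + 1))),
      HasDerivWithinAt α (f t (α t)) (Icc a (a + 1 / (2 * (K + 1)))) t := by
  have hτ : (0 : ℝ) < 1 / (2 * (K + 1)) := by positivity
  obtain ⟨M, hM⟩ := isCompact_Icc.exists_bound_of_continuousOn
    (s := Icc a (a + 1 / (2 * ((K : ℝ) + 1)))) (hc x).continuousOn
  have hM' : ∀ t ∈ Icc a (a + 1 / (2 * ((K : ℝ) + 1))), ‖f t x‖ ≤ M.toNNReal :=
    fun t ht => (hM t ht).trans (Real.le_coe_toNNReal M)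
  have hP : IsPicardLindelof f (tmin := a) (tmax := a + 1 / (2 * ((K : ℝ) + 1)))
      ⟨a, le_rfl, by linarith⟩ x M.toNNReal 0 (M.toNNReal + K * M.toNNReal) K :=
    { lipschitzOnWith := fun t _ => (hf t).lipschitzOnWith
      continuousOn := fun y _ => (hc y).continuousOn
      norm_le := fun t ht y hy => by
        have h1 := (hf t).dist_le_mul y x
        rw [dist_eq_norm] at h1
        have h2 : ‖f t y‖ ≤ ‖f t y - f t x‖ + ‖f t x‖ := by
          simpa using norm_add_le (f t y - f t x) (f t x)
        have h3 : (K : ℝ) * dist y x ≤ K * M.toNNReal := by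
          gcongr
          exact hy
        push_cast
        linarith [hM' t ht]
      mul_max_le := by
        have : max (a + 1 / (2 * ((K : ℝ) + 1)) - a) (a - a) = 1 / (2 * ((K : ℝ) + 1)) := by
          rw [max_eq_left] <;> linarith
        simp only [this]
        push_cast
        rw [mul_one_div, div_le_iff₀ (by positivity)]
        nlinarith [mul_nonneg (NNReal.coe_nonneg K) (NNReal.coe_nonneg M.toNNReal),
          NNReal.coe_nonneg M.toNNReal] }
  exact hP.exists_eq_forall_mem_Icc_hasDerivWithinAt₀

theorem exists_solution_of_lipschitz [CompleteSpace E] {f : ℝ → E → E} {K : ℝ≥0}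
    (hf : ∀ t, LipschitzWith K (f t)) (hc : ∀ x, Continuous (f · x)) (T : ℝ) (x : E) :
    ∃ α : ℝ → E, α 0 = x ∧ ∀ t ∈ Icc 0 T, HasDerivWithinAt α (f t (α t)) (Icc 0 T) t := by
  have hτ : (0 : ℝ) < 1 / (2 * (K + 1)) := by positivity
  have key : ∀ n : ℕ, ∃ α : ℝ → E, α 0 = x ∧ ∀ t ∈ Icc 0 (n * (1 / (2 * ((K : ℝ) + 1)))),
      HasDerivWithinAt α (f t (α t)) (Icc 0 (n * (1 / (2 * ((K : ℝ) + 1))))) t := by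
    intro n
    induction n with
    | zero =>
      refine ⟨fun _ => x, rfl, fun t ht => ?_⟩
      have : Icc (0 : ℝ) ((0 : ℕ) * (1 / (2 * ((K : ℝ) + 1)))) = {0} := by simp
      rw [this] at ht ⊢
      rw [mem_singleton_iff.1 ht]
      exact HasFDerivWithinAt.of_subsingleton subsingleton_singleton
    | succ n ih =>
      obtain ⟨α, h0, hα⟩ := ih
      set b : ℝ := n * (1 / (2 * ((K : ℝ) + 1))) with hb
      have hb0 : 0 ≤ b := by positivity
      obtain ⟨β, hβ0, hβ⟩ := exists_solution_of_lipschitz_short hf hc b (α b)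
      have hn : ((n + 1 : ℕ) : ℝ) * (1 / (2 * ((K : ℝ) + 1))) = b + 1 / (2 * (K + 1)) := by
        rw [hb]; push_cast; ring
      rw [hn]
      refine ⟨fun s => if s ≤ b then α s else β s, by simp [hb0, h0], ?_⟩
      refine HasDerivWithinAt.glue hb0 (by linarith) hβ0.symm (fun t ht => ?_) (fun t ht => ?_)
      · simpa [ht.2] using hα t ht
      · by_cases htb : t ≤ b
        · have : t = b := le_antisymm htb ht.1
          subst this
          simpa [hβ0] using hβ b ht
        · simpa [htb] using hβ t ht
  obtain ⟨n, hn⟩ := exists_nat_ge (T / (1 / (2 * ((K : ℝ) + 1))))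
  rw [div_le_iff₀ hτ] at hn
  obtain ⟨α, h0, hα⟩ := key n
  exact ⟨α, h0, fun t ht => (hα t ⟨ht.1, ht.2.trans hn⟩).mono (Icc_subset_Icc_right hn)⟩

theorem HasDerivWithinAt.Ici_of_Icc {α : ℝ → E} {α' : E} {a b t : ℝ} (ht : t ∈ Ico a b)
    (h : HasDerivWithinAt α α' (Icc a b) t) : HasDerivWithinAt α α' (Ici t) t :=
  h.mono_of_mem_nhdsWithin (Icc_mem_nhdsGE_of_mem ht)

theorem eqOn_of_lipschitz {f : ℝ → E → E} {K : ℝ≥0} {T : ℝ}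
    (hf : ∀ t ∈ Icc 0 T, LipschitzWith K (f t)) {α β : ℝ → E}
    (hα : ∀ t ∈ Icc 0 T, HasDerivWithinAt α (f t (α t)) (Icc 0 T) t)
    (hβ : ∀ t ∈ Icc 0 T, HasDerivWithinAt β (f t (β t)) (Icc 0 T) t) (h : α 0 = β 0) :
    EqOn α β (Icc 0 T) :=
  ODE_solution_unique_of_mem_Icc_right (s := fun _ => univ)
    (fun t ht => (hf t (Ico_subset_Icc_self ht)).lipschitzOnWith)
    (fun t ht => (hα t ht).continuousWithinAt)
    (fun t ht => (hα t (Ico_subset_Icc_self ht)).Ici_of_Icc ht) (fun _ _ => mem_univ _)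
    (fun t ht => (hβ t ht).continuousWithinAt)
    (fun t ht => (hβ t (Ico_subset_Icc_self ht)).Ici_of_Icc ht) (fun _ _ => mem_univ _) h

end ODE

/-! ### Velocity fields with uniform constants -/

/-- A velocity field that is continuous in `(t, x)`, and Lipschitz in space and in the measure
with constants `L`, `K` that do not depend on the time in `[0, T]`. -/
structure IsUniformField {d : ℕ} (V : ProbCpt d → ℝ → Eucl d → Eucl d) (T : ℝ) (L K : ℝ≥0) :
    Prop where
  continuous : ∀ μ, Continuous (Function.uncurry (V μ))
  lipschitz_space : ∀ t ∈ Icc 0 T, ∀ μ, LipschitzWith L (V μ t)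
  lipschitz_measure : ∀ t ∈ Icc 0 T, ∀ μ ν x, ‖V μ t x - V ν t x‖ ≤ K * μ.W1 ν

theorem LocBounded.exists_bound {K : ℝ → ℝ} (hK : LocBounded K) (a b : ℝ) :
    ∃ C : ℝ≥0, ∀ᵐ t : ℝ, t ∈ Icc a b → K t ≤ C := by
  have h := (hK a b).2
  rw [eLpNorm_exponent_top] at h
  refine ⟨(eLpNormEssSup K (volume.restrict (Icc a b))).toNNReal, ?_⟩
  rw [← ae_restrict_iff' measurableSet_Icc]
  filter_upwards [ae_le_eLpNormEssSup (f := K) (μ := volume.restrict (Icc a b))] with t ht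
  have h1 := ENNReal.toNNReal_mono h.ne ht
  rw [enorm_eq_nnnorm, ENNReal.toNNReal_coe] at h1
  exact (le_abs_self _).trans (by exact_mod_cast h1)

theorem forall_mem_Icc_of_ae {T : ℝ} {p : ℝ → Prop}
    (h : ∀ᵐ t : ℝ, t ∈ Icc (-1) (T + 1) → p t) (hp : IsClosed {t | p t}) :
    ∀ t ∈ Icc 0 T, p t := by
  intro t ht
  have h1 : t ∈ closure (Ioo (-1) (T + 1) ∩ {t | t ∈ Icc (-1) (T + 1) → p t}) :=
    (Measure.dense_of_ae h).open_subset_closure_inter isOpen_Ioo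
      ⟨by linarith [ht.1], by linarith [ht.2]⟩
  exact closure_minimal (fun s hs => hs.2 (Ioo_subset_Icc_self hs.1)) hp h1

/-- The bounds of `IsVelocityField` hold for almost every time, hence for all times since the
field is continuous in time. -/
theorem IsVelocityField.exists_isUniformField {d : ℕ} {V : ProbCpt d → ℝ → Eucl d → Eucl d}
    (hV : IsVelocityField V) (T : ℝ) : ∃ L K : ℝ≥0, IsUniformField V T L K := by
  obtain ⟨L, hL, hLV⟩ := hV.lipschitz_space
  obtain ⟨K, hK, hKV⟩ := hV.lipschitz_measure
  obtain ⟨L', hL'⟩ := hL.exists_bound (-1) (T + 1)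
  obtain ⟨K', hK'⟩ := hK.exists_bound (-1) (T + 1)
  have hc : ∀ μ x, Continuous fun t => V μ t x := fun μ x =>
    (hV.contDiff μ).continuous.comp (by fun_prop : Continuous fun t : ℝ => (t, x))
  refine ⟨L', K', fun μ => (hV.contDiff μ).continuous, fun t ht μ => ?_, fun t ht μ ν x => ?_⟩
  · refine LipschitzWith.of_dist_le_mul fun x y => ?_
    rw [dist_eq_norm, dist_eq_norm]
    refine forall_mem_Icc_of_ae (p := fun t => ‖V μ t x - V μ t y‖ ≤ L' * ‖x - y‖) ?_
      (isClosed_le ((hc μ x).sub (hc μ y)).norm continuous_const) t ht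
    filter_upwards [hLV, hL'] with s h1 h2 hs
    exact (h1 μ x y).trans (by gcongr; exact h2 hs)
  · refine forall_mem_Icc_of_ae (p := fun t => ‖V μ t x - V ν t x‖ ≤ K' * μ.W1 ν) ?_
      (isClosed_le ((hc μ x).sub (hc ν x)).norm continuous_const) t ht
    filter_upwards [hKV, hK'] with s h1 h2 hs
    refine (h1 μ ν x).trans (mul_le_mul_of_nonneg_right (h2 hs) (μ.W1_nonneg ν))

/-- Continuity on `[0, T]` of a curve of measures for the distance `W₁`. -/
def W1ContinuousOn {d : ℕ} (T : ℝ) (μ : ℝ → ProbCpt d) : Prop :=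
  ∀ t ∈ Icc 0 T, Tendsto (fun s => (μ s).W1 (μ t)) (𝓝[Icc 0 T] t) (𝓝 0)

/-- The time-dependent field `V(t, μ_t)` along a curve of measures, extended to all times by
freezing it outside `[0, T]`. -/
def fieldAlong {d : ℕ} (V : ProbCpt d → ℝ → Eucl d → Eucl d) {T : ℝ} (hT : 0 ≤ T)
    (μ : ℝ → ProbCpt d) (t : ℝ) (x : Eucl d) : Eucl d :=
  V (μ (projIcc 0 T hT t)) (projIcc 0 T hT t) x

section

variable {d : ℕ} {V : ProbCpt d → ℝ → Eucl d → Eucl d} {T : ℝ} {L K : ℝ≥0}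

theorem fieldAlong_of_mem (hT : 0 ≤ T) (μ : ℝ → ProbCpt d) {t : ℝ} (ht : t ∈ Icc 0 T) :
    fieldAlong V hT μ t = V (μ t) t := by
  funext x
  simp [fieldAlong, projIcc_of_mem hT ht]

namespace IsUniformField

theorem lipschitzWith_fieldAlong (hV : IsUniformField V T L K) (hT : 0 ≤ T) (μ : ℝ → ProbCpt d)
    (t : ℝ) : LipschitzWith L (fieldAlong V hT μ t) :=
  hV.lipschitz_space _ (projIcc 0 T hT t).2 _

theorem continuous_fieldAlong (hV : IsUniformField V T L K) (hT : 0 ≤ T) {μ : ℝ → ProbCpt d}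
    (hμ : W1ContinuousOn T μ) : Continuous (Function.uncurry (fieldAlong V hT μ)) := by
  refine continuous_prod_of_continuous_lipschitzWith' _ L
    (hV.lipschitzWith_fieldAlong hT μ) fun x => ?_
  have h : ContinuousOn (fun s => V (μ s) s x) (Icc 0 T) := by
    intro t ht
    rw [ContinuousWithinAt, tendsto_iff_norm_sub_tendsto_zero]
    have h1 : Tendsto (fun s => (K : ℝ) * (μ s).W1 (μ t) + ‖V (μ t) s x - V (μ t) t x‖)
        (𝓝[Icc 0 T] t) (𝓝 0) := by
      have hc : Continuous fun s => V (μ t) s x :=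
        (hV.continuous (μ t)).comp (by fun_prop : Continuous fun s : ℝ => (s, x))
      have h2 := tendsto_iff_norm_sub_tendsto_zero.1
        (hc.continuousWithinAt (s := Icc 0 T) (x := t)).tendsto
      simpa using ((hμ t ht).const_mul (K : ℝ)).add h2
    refine squeeze_zero' (Eventually.of_forall fun _ => norm_nonneg _) ?_ h1
    filter_upwards [self_mem_nhdsWithin] with s hs
    calc ‖V (μ s) s x - V (μ t) t x‖
        ≤ ‖V (μ s) s x - V (μ t) s x‖ + ‖V (μ t) s x - V (μ t) t x‖ :=
          norm_sub_le_norm_sub_add_norm_sub _ _ _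
      _ ≤ _ := by gcongr; exact hV.lipschitz_measure s hs _ _ _
  exact h.comp_continuous (by fun_prop : Continuous fun t => ((projIcc 0 T hT t : Icc 0 T) : ℝ))
    fun t => (projIcc 0 T hT t).2

end IsUniformField

/-! ### The flow on a space of continuous maps -/

section Push

variable {S : Type*} [TopologicalSpace S]

/-- The map `Y ↦ b(t, Y(·))` on continuous maps. -/
def fieldComp (b : ℝ → Eucl d → Eucl d) (hb : Continuous (Function.uncurry b)) (t : ℝ)
    (Y : C(S, Eucl d)) : C(S, Eucl d) :=
  ⟨fun s => b t (Y s), hb.comp (by fun_prop : Continuous fun s => (t, Y s))⟩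

theorem continuous_fieldComp (b : ℝ → Eucl d → Eucl d) (hb : Continuous (Function.uncurry b))
    (Y : C(S, Eucl d)) : Continuous fun t => fieldComp b hb t Y :=
  (ContinuousMap.curry ⟨fun p : ℝ × S => b p.1 (Y p.2),
    hb.comp (by fun_prop : Continuous fun p : ℝ × S => (p.1, Y p.2))⟩).continuous

variable [CompactSpace S]

theorem lipschitzWith_fieldComp {b : ℝ → Eucl d → Eucl d} (hb : Continuous (Function.uncurry b))
    {t : ℝ} {M : ℝ≥0} (h : LipschitzWith M (b t)) :
    LipschitzWith M (fieldComp (S := S) b hb t) := by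
  refine LipschitzWith.of_dist_le_mul fun Y Z => ?_
  rw [ContinuousMap.dist_le (by positivity)]
  exact fun s => (h.dist_le_mul _ _).trans (by gcongr; exact ContinuousMap.dist_apply_le_dist s)

variable [MeasurableSpace S] [BorelSpace S]

/-- The law of the continuous map `Y` under the probability measure `P` on a compact space. -/
def pushCpt (P : Measure S) [IsProbabilityMeasure P] (Y : C(S, Eucl d)) : ProbCpt d :=
  ⟨⟨P.map Y, Measure.isProbabilityMeasure_map Y.continuous.aemeasurable⟩, range Y,
    isCompact_range Y.continuous, by
      change P.map Y (range Y)ᶜ = 0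
      rw [Measure.map_apply Y.continuous.measurable
        (isCompact_range Y.continuous).measurableSet.compl]
      simp⟩

variable (P : Measure S) [IsProbabilityMeasure P]

theorem toMeasure_pushCpt (Y : C(S, Eucl d)) : (pushCpt P Y).toMeasure = P.map Y := rfl

theorem W1_pushCpt_le (Y Z : C(S, Eucl d)) : (pushCpt P Y).W1 (pushCpt P Z) ≤ dist Y Z := by
  refine ENNReal.toReal_le_of_le_ofReal dist_nonneg ?_
  refine (wass_map_le P Y.continuous.measurable Z.continuous.measurable).trans ?_
  calc ∫⁻ s, edist (Y s) (Z s) ∂P ≤ ∫⁻ _, ENNReal.ofReal (dist Y Z) ∂P := by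
        refine lintegral_mono fun s => ?_
        rw [edist_dist]
        exact ENNReal.ofReal_le_ofReal (ContinuousMap.dist_apply_le_dist s)
    _ = _ := by simp

theorem w1ContinuousOn_pushCpt {Y : ℝ → C(S, Eucl d)} (hY : ContinuousOn Y (Icc 0 T)) :
    W1ContinuousOn T fun t => pushCpt P (Y t) := fun t ht =>
  squeeze_zero (fun _ => ProbCpt.W1_nonneg _ _) (fun _ => W1_pushCpt_le P _ _)
    (tendsto_iff_dist_tendsto_zero.1 (hY t ht).tendsto)

theorem IsUniformField.lipschitzWith_selfConsistent (hV : IsUniformField V T L K) {t : ℝ}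
    (ht : t ∈ Icc 0 T) :
    LipschitzWith (L + K) fun Y : C(S, Eucl d) =>
      fieldComp (V (pushCpt P Y)) (hV.continuous _) t Y := by
  refine LipschitzWith.of_dist_le_mul fun Y Z => ?_
  rw [ContinuousMap.dist_le (by positivity)]
  intro s
  calc dist (V (pushCpt P Y) t (Y s)) (V (pushCpt P Z) t (Z s))
      ≤ dist (V (pushCpt P Y) t (Y s)) (V (pushCpt P Y) t (Z s))
        + dist (V (pushCpt P Y) t (Z s)) (V (pushCpt P Z) t (Z s)) := dist_triangle _ _ _
    _ ≤ L * dist Y Z + K * dist Y Z := by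
        gcongr
        · exact ((hV.lipschitz_space t ht _).dist_le_mul _ _).trans
            (by gcongr; exact ContinuousMap.dist_apply_le_dist s)
        · rw [dist_eq_norm]
          exact (hV.lipschitz_measure t ht _ _ _).trans (by gcongr; exact W1_pushCpt_le P Y Z)
    _ = _ := by push_cast; ring

/-- The nonlocal equation in Lagrangian form is an ordinary differential equation with a Lipschitz
right-hand side on the Banach space `C(S, ℝ^d)`. -/
theorem IsUniformField.exists_selfConsistent_flow (hV : IsUniformField V T L K) (hT : 0 ≤ T)
    (Y₀ : C(S, Eucl d)) : ∃ Y : ℝ → C(S, Eucl d), Y 0 = Y₀ ∧ ∀ t ∈ Icc 0 T,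
      HasDerivWithinAt Y (fieldComp (V (pushCpt P (Y t))) (hV.continuous _) t (Y t))
        (Icc 0 T) t := by
  obtain ⟨Y, h0, hY⟩ := exists_solution_of_lipschitz
    (f := fun t Y => fieldComp (V (pushCpt P Y)) (hV.continuous _) (projIcc 0 T hT t) Y)
    (fun t => hV.lipschitzWith_selfConsistent P (projIcc 0 T hT t).2)
    (fun Y => (continuous_fieldComp _ (hV.continuous _) Y).comp
      (by fun_prop : Continuous fun t => ((projIcc 0 T hT t : Icc 0 T) : ℝ))) T Y₀
  refine ⟨Y, h0, fun t ht => ?_⟩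
  have := hY t ht
  rwa [projIcc_of_mem hT ht] at this

end Push
end

/-! ### Push-forwards by a flow solve the continuity equation -/

/-- `μ` is a `W₁`-continuous distributional solution on `[0, T]` of the linear continuity equation
`∂_t μ_t + div (b_t μ_t) = 0`. -/
structure IsContinuitySolution {d : ℕ} (b : ℝ → Eucl d → Eucl d) (T : ℝ) (μ : ℝ → ProbCpt d) :
    Prop where
  continuous : W1ContinuousOn T μ
  intervalIntegrable : ∀ φ : Eucl d → ℝ, ContDiff ℝ ∞ φ → HasCompactSupport φ →
    IntervalIntegrable (fun s => ∫ x, fderiv ℝ φ x (b s x) ∂(μ s).toMeasure) volume 0 T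
  weak : ∀ φ : Eucl d → ℝ, ContDiff ℝ ∞ φ → HasCompactSupport φ → ∀ t ∈ Icc 0 T,
    ∫ x, φ x ∂(μ t).toMeasure = ∫ x, φ x ∂(μ 0).toMeasure
      + ∫ s in (0 : ℝ)..t, ∫ x, fderiv ℝ φ x (b s x) ∂(μ s).toMeasure

section

variable {d : ℕ} {T : ℝ} {S : Type*} [TopologicalSpace S] [CompactSpace S]

theorem hasDerivWithinAt_apply {Y : ℝ → C(S, Eucl d)} {Y' : C(S, Eucl d)} {A : Set ℝ} {t : ℝ}
    (h : HasDerivWithinAt Y Y' A t) (s : S) :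
    HasDerivWithinAt (fun t => Y t s) (Y' s) A t :=
  (ContinuousMap.evalCLM ℝ s : C(S, Eucl d) →L[ℝ] Eucl d).hasFDerivAt.comp_hasDerivWithinAt t h

variable [MeasurableSpace S] [BorelSpace S] (P : Measure S) [IsProbabilityMeasure P]

theorem integral_pushCpt {F : Type*} [NormedAddCommGroup F] [NormedSpace ℝ F] {g : Eucl d → F}
    (hg : Continuous g) (Y : C(S, Eucl d)) :
    ∫ x, g x ∂(pushCpt P Y).toMeasure = ∫ s, g (Y s) ∂P := by
  rw [toMeasure_pushCpt, integral_map Y.continuous.aemeasurable hg.aestronglyMeasurable]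

theorem isContinuitySolution_pushCpt [T2Space S] (hT : 0 ≤ T) {b : ℝ → Eucl d → Eucl d}
    (hb : Continuous (Function.uncurry b)) {Y : ℝ → C(S, Eucl d)}
    (hY : ∀ t ∈ Icc 0 T, HasDerivWithinAt Y (fieldComp b hb t (Y t)) (Icc 0 T) t) :
    IsContinuitySolution b T fun t => pushCpt P (Y t) := by
  have hYc : ContinuousOn Y (Icc 0 T) := fun t ht => (hY t ht).continuousWithinAt
  have hYp : Continuous fun t => Y (projIcc 0 T hT t) :=
    hYc.comp_continuous (by fun_prop) fun t => (projIcc 0 T hT t).2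
  have hYp' : Continuous fun p : ℝ × S => Y (projIcc 0 T hT p.1) p.2 :=
    ContinuousEval.continuous_eval.comp
      ((hYp.comp continuous_fst).prodMk continuous_snd)
  -- the integrand of the weak formulation in Lagrangian variables
  have hg : ∀ φ : Eucl d → ℝ, ContDiff ℝ ∞ φ → Continuous (Function.uncurry fun (r : ℝ) (s : S) =>
      fderiv ℝ φ (Y (projIcc 0 T hT r) s) (b r (Y (projIcc 0 T hT r) s))) := fun φ hφ => by
    have h1 : Continuous fun p : ℝ × S => b p.1 (Y (projIcc 0 T hT p.1) p.2) :=
      hb.comp (continuous_fst.prodMk hYp')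
    have h2 : Continuous (fderiv ℝ φ) := hφ.continuous_fderiv (by simp)
    exact (h2.comp hYp').clm_apply h1
  have hcont : ∀ φ : Eucl d → ℝ, ContDiff ℝ ∞ φ → Continuous fun r => ∫ s,
      fderiv ℝ φ (Y (projIcc 0 T hT r) s) (b r (Y (projIcc 0 T hT r) s)) ∂P := fun φ hφ => by
    simpa using continuous_parametric_integral_of_continuous (μ := P) (hg φ hφ) isCompact_univ
  have hpush : ∀ φ : Eucl d → ℝ, ContDiff ℝ ∞ φ → ∀ r ∈ Icc 0 T,
      ∫ x, fderiv ℝ φ x (b r x) ∂(pushCpt P (Y r)).toMeasure = ∫ s,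
      fderiv ℝ φ (Y (projIcc 0 T hT r) s) (b r (Y (projIcc 0 T hT r) s)) ∂P := by
    intro φ hφ r hr
    have h1 : Continuous (b r) := hb.comp (by fun_prop : Continuous fun x : Eucl d => (r, x))
    have h2 : Continuous (fderiv ℝ φ) := hφ.continuous_fderiv (by simp)
    rw [integral_pushCpt P (h2.clm_apply h1), projIcc_of_mem hT hr]
  refine ⟨w1ContinuousOn_pushCpt P hYc, fun φ hφ _ => ?_, fun φ hφ _ t ht => ?_⟩
  · refine ((hcont φ hφ).intervalIntegrable 0 T).congr_uIoo ?_
    intro r hr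
    rw [uIoo_of_le hT] at hr
    exact (hpush φ hφ r (Ioo_subset_Icc_self hr)).symm
  · have hsub : Icc 0 t ⊆ Icc 0 T := Icc_subset_Icc_right ht.2
    have hFTC : ∀ s, ∫ r in (0 : ℝ)..t,
        fderiv ℝ φ (Y (projIcc 0 T hT r) s) (b r (Y (projIcc 0 T hT r) s))
          = φ (Y t s) - φ (Y 0 s) := by
      intro s
      refine intervalIntegral.integral_eq_sub_of_hasDeriv_right_of_le ht.1
        (f := fun r => φ (Y r s)) ?_ (fun r hr => ?_) ?_
      · exact fun r hr => hφ.continuous.continuousAt.comp_continuousWithinAt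
          ((hasDerivWithinAt_apply (hY r (hsub hr)) s).continuousWithinAt.mono hsub)
      · have hr' : r ∈ Ico 0 T := ⟨hr.1.le, hr.2.trans_le ht.2⟩
        have h1 := ((hasDerivWithinAt_apply (hY r (Ico_subset_Icc_self hr')) s).Ici_of_Icc
          hr').mono Ioi_subset_Ici_self
        have h2 := ((hφ.differentiable (by simp)) (Y r s)).hasFDerivAt.comp_hasDerivWithinAt r h1
        rw [projIcc_of_mem hT (Ico_subset_Icc_self hr')]
        exact h2
      · exact ((hg φ hφ).comp (by fun_prop : Continuous fun r : ℝ => (r, s))).intervalIntegrable _ _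
    have hint : Integrable (Function.uncurry fun (r : ℝ) (s : S) =>
        fderiv ℝ φ (Y (projIcc 0 T hT r) s) (b r (Y (projIcc 0 T hT r) s)))
        ((volume.restrict (uIoc 0 t)).prod P) := by
      have h1 : IntegrableOn (Function.uncurry fun (r : ℝ) (s : S) =>
          fderiv ℝ φ (Y (projIcc 0 T hT r) s) (b r (Y (projIcc 0 T hT r) s)))
          (Icc 0 t ×ˢ univ) (volume.prod P) :=
        (hg φ hφ).continuousOn.integrableOn_compact (isCompact_Icc.prod isCompact_univ)
      rw [uIoc_of_le ht.1]
      have h2 := h1.mono_set (prod_mono (Ioc_subset_Icc_self) (subset_refl (univ : Set S)))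
      rwa [IntegrableOn, ← Measure.prod_restrict, Measure.restrict_univ] at h2
    have hφi : ∀ Z : C(S, Eucl d), Integrable (fun s => φ (Z s)) P := fun Z => by
      have := (hφ.continuous.comp Z.continuous).continuousOn.integrableOn_compact
        (μ := P) isCompact_univ
      rwa [integrableOn_univ] at this
    have hswap := intervalIntegral_integral_swap hint
    simp only [hFTC] at hswap
    rw [integral_sub (hφi _) (hφi _)] at hswap
    rw [integral_pushCpt P hφ.continuous, integral_pushCpt P hφ.continuous,
      intervalIntegral.integral_congr (g := fun r => ∫ s, fderiv ℝ φ (Y (projIcc 0 T hT r) s)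
        (b r (Y (projIcc 0 T hT r) s)) ∂P), hswap]
    · ring
    · intro r hr
      rw [uIcc_of_le ht.1] at hr
      exact hpush φ hφ r (hsub hr)

end

/-! ### Mollification of Lipschitz functions -/

section Mollify

variable {d : ℕ} (ρ : ContDiffBump (0 : Eucl d))

/-- The convolution of `u` with a smooth probability density supported in a ball of radius
`ρ.rOut` around `0`. -/
def mollify (u : Eucl d → ℝ) : Eucl d → ℝ :=
  convolution (ρ.normed volume) u (ContinuousLinearMap.lsmul ℝ ℝ) volume

theorem mollify_apply (u : Eucl d → ℝ) (x : Eucl d) :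
    mollify ρ u x = ∫ y, ρ.normed volume y * u (x - y) := by
  simp [mollify, convolution_def]

theorem contDiff_mollify {u : Eucl d → ℝ} (hu : Continuous u) : ContDiff ℝ ∞ (mollify ρ u) :=
  ρ.hasCompactSupport_normed.contDiff_convolution_left _ ρ.contDiff_normed hu.locallyIntegrable

/-- Two averages against the density `ρ` are as close as the functions on the support of `ρ`. -/
theorem abs_integral_normed_sub_le {f g : Eucl d → ℝ} (hf : Continuous f) (hg : Continuous g)
    {c : ℝ} (h : ∀ y, ‖y‖ ≤ ρ.rOut → |f y - g y| ≤ c) :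
    |(∫ y, ρ.normed volume y * f y) - ∫ y, ρ.normed volume y * g y| ≤ c := by
  have hi : ∀ {f : Eucl d → ℝ}, Continuous f → Integrable fun y => ρ.normed volume y * f y :=
    fun hf => (ρ.contDiff_normed (n := 0).continuous.mul hf).integrable_of_hasCompactSupport
      ρ.hasCompactSupport_normed.mul_right
  rw [← integral_sub (hi hf) (hi hg), ← Real.norm_eq_abs]
  have h1 : ∫ y, ρ.normed volume y * c = c := by
    rw [integral_mul_const, ρ.integral_normed, one_mul]
  rw [← h1]
  refine norm_integral_le_of_norm_le (hi continuous_const) (Eventually.of_forall fun y => ?_)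
  rw [← mul_sub, norm_mul, Real.norm_of_nonneg (ρ.nonneg_normed y), Real.norm_eq_abs]
  by_cases hy : ‖y‖ ≤ ρ.rOut
  · exact mul_le_mul_of_nonneg_left (h y hy) (ρ.nonneg_normed y)
  · have : ρ.normed volume y = 0 := by
      rw [← Function.notMem_support, ρ.support_normed_eq]
      simpa using (not_le.1 hy).le
    simp [this]

theorem abs_mollify_sub_le {u : Eucl d → ℝ} (hu : Continuous u) {c : ℝ} {x : Eucl d}
    (h : ∀ y, ‖y‖ ≤ ρ.rOut → |u (x - y) - u x| ≤ c) : |mollify ρ u x - u x| ≤ c := by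
  have h1 : ∫ y, ρ.normed volume y * u x = u x := by
    rw [integral_mul_const, ρ.integral_normed, one_mul]
  have := abs_integral_normed_sub_le ρ (f := fun y => u (x - y)) (g := fun _ => u x)
    (by fun_prop) continuous_const h
  rwa [h1, ← mollify_apply] at this

theorem mollify_eq_zero {u : Eucl d → ℝ} (hu : Continuous u) {R : ℝ}
    (h : ∀ x, R ≤ ‖x‖ → u x = 0) {x : Eucl d} (hx : R + ρ.rOut ≤ ‖x‖) : mollify ρ u x = 0 := by
  have hx0 : u x = 0 := h x (by linarith [ρ.rOut_pos])
  have := abs_mollify_sub_le ρ hu (c := 0) (x := x) fun y hy => by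
    rw [hx0, h (x - y) (by linarith [norm_sub_norm_le x y])]; simp
  rw [hx0, sub_zero] at this
  exact abs_nonpos_iff.1 this

theorem abs_mollify_sub_le_of_lipschitz {u : Eucl d → ℝ} {A : ℝ≥0} (hu : LipschitzWith A u)
    (x : Eucl d) : |mollify ρ u x - u x| ≤ A * ρ.rOut :=
  abs_mollify_sub_le ρ hu.continuous fun y hy => by
    have := hu.dist_le_mul (x - y) x
    rw [Real.dist_eq, dist_eq_norm, sub_sub_cancel_left, norm_neg] at this
    exact this.trans (by gcongr)

theorem lipschitzWith_mollify {u : Eucl d → ℝ} {A : ℝ≥0} (hu : LipschitzWith A u) :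
    LipschitzWith A (mollify ρ u) := by
  refine LipschitzWith.of_dist_le_mul fun x y => ?_
  rw [Real.dist_eq, mollify_apply, mollify_apply]
  have hc := hu.continuous
  refine abs_integral_normed_sub_le ρ (f := fun z => u (x - z)) (g := fun z => u (y - z))
    (by fun_prop) (by fun_prop) fun z _ => ?_
  have := hu.dist_le_mul (x - z) (y - z)
  rwa [dist_sub_right, Real.dist_eq] at this

/-- The commutator of mollification with the composition with a perturbation `x ↦ x + v x` of the
identity is small with the Lipschitz constant `ℓ` of `v`. -/
theorem abs_mollify_comp_sub_le {u : Eucl d → ℝ} {A ℓ : ℝ≥0} (hu : LipschitzWith A u)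
    {v : Eucl d → Eucl d} (hv : LipschitzWith ℓ v) (x : Eucl d) :
    |mollify ρ u (x + v x) - mollify ρ (fun z => u (z + v z)) x| ≤ A * (ℓ * ρ.rOut) := by
  rw [mollify_apply, mollify_apply]
  have hc := hu.continuous
  have hc' := hv.continuous
  refine abs_integral_normed_sub_le ρ (f := fun y => u (x + v x - y))
    (g := fun y => u (x - y + v (x - y))) (by fun_prop) (by fun_prop) fun y hy => ?_
  have h1 := hu.dist_le_mul (x + v x - y) (x - y + v (x - y))
  have h2 := hv.dist_le_mul x (x - y)
  rw [dist_eq_norm, dist_eq_norm, sub_sub_cancel] at h2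
  rw [Real.dist_eq, dist_eq_norm, show x + v x - y - (x - y + v (x - y)) = v x - v (x - y) by abel]
    at h1
  exact h1.trans (by gcongr; exact h2.trans (by gcongr))

theorem fderiv_mollify {u : Eucl d → ℝ} (hu : Continuous u) (x : Eucl d) :
    fderiv ℝ (mollify ρ u) x = ∫ y, u (x - y) • fderiv ℝ (ρ.normed volume) y := by
  have h1 := (ρ.hasCompactSupport_normed (μ := volume)).hasFDerivAt_convolution_left (μ := volume)
    (ContinuousLinearMap.lsmul ℝ ℝ : ℝ →L[ℝ] ℝ →L[ℝ] ℝ) ρ.contDiff_normed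
    (hu.locallyIntegrable (μ := volume)) x
  refine h1.fderiv.trans ?_
  rw [convolution_def]
  refine integral_congr_ae (Eventually.of_forall fun y => ?_)
  ext v
  simp [ContinuousLinearMap.precompL_apply, mul_comm]

theorem integrable_smul_fderiv_normed {c : Eucl d → ℝ} (hc : Continuous c) :
    Integrable fun y => c y • fderiv ℝ (ρ.normed volume) y := by
  have hρ : ContDiff ℝ 1 (ρ.normed volume) := ρ.contDiff_normed
  have hρc : Continuous (fderiv ℝ (ρ.normed volume)) := hρ.continuous_fderiv one_ne_zero
  have hρs : HasCompactSupport (fderiv ℝ (ρ.normed volume)) :=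
    (ρ.hasCompactSupport_normed (μ := volume)).fderiv ℝ
  exact (hc.smul hρc).integrable_of_hasCompactSupport hρs.smul_left

theorem exists_lipschitz_fderiv_mollify : ∃ B : ℝ≥0, ∀ (A : ℝ≥0) (u : Eucl d → ℝ),
    LipschitzWith A u → LipschitzWith (B * A) (fderiv ℝ (mollify ρ u)) := by
  refine ⟨(∫ y, ‖fderiv ℝ (ρ.normed volume) y‖).toNNReal,
    fun A u hu => LipschitzWith.of_dist_le_mul fun x x' => ?_⟩
  have hD := fderiv_mollify ρ hu.continuous
  have hc := hu.continuous
  have hi : ∀ x, Integrable fun y => u (x - y) • fderiv ℝ (ρ.normed volume) y := fun x =>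
    integrable_smul_fderiv_normed ρ (by fun_prop)
  have hn : 0 ≤ ∫ y, ‖fderiv ℝ (ρ.normed volume) y‖ := integral_nonneg fun y => norm_nonneg _
  have h1 : (((∫ y, ‖fderiv ℝ (ρ.normed volume) y‖).toNNReal * A : ℝ≥0) : ℝ) * dist x x'
      = ∫ y, ‖fderiv ℝ (ρ.normed volume) y‖ * (A * dist x x') := by
    rw [integral_mul_const, NNReal.coe_mul, mul_assoc, Real.coe_toNNReal _ hn]
  rw [h1, dist_eq_norm, hD, hD, ← integral_sub (hi x) (hi x')]
  have hm : Integrable fun y => ‖fderiv ℝ (ρ.normed volume) y‖ * (A * dist x x') := by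
    simpa using (integrable_smul_fderiv_normed ρ (c := fun _ => 1) continuous_const).norm.mul_const
      (A * dist x x')
  refine norm_integral_le_of_norm_le hm (Eventually.of_forall fun y => ?_)
  have h2 := hu.dist_le_mul (x - y) (x' - y)
  rw [dist_sub_right, dist_eq_norm] at h2
  rw [← sub_smul, norm_smul, mul_comm]
  exact mul_le_mul_of_nonneg_left h2 (norm_nonneg _)

end Mollify

/-- Lipschitz functions with bounded support determine a compactly supported probability
measure. -/
theorem ProbCpt.ext_of_lipschitz {d : ℕ} {μ ν : ProbCpt d}
    (h : ∀ (A : ℝ≥0) (R : ℝ) (φ : Eucl d → ℝ), LipschitzWith A φ → (∀ x, R ≤ ‖x‖ → φ x = 0) →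
      ∫ x, φ x ∂μ.toMeasure = ∫ x, φ x ∂ν.toMeasure) : μ = ν := by
  apply ProbCpt.toMeasure_injective
  refine Measure.ext_of_integral_eq_on_compactlySupported fun f => ?_
  have hf : Continuous f := f.continuous
  obtain ⟨R, hR⟩ : ∃ R : ℝ, ∀ x, R ≤ ‖x‖ → f x = 0 := by
    obtain ⟨R, hR⟩ := f.hasCompactSupport.isCompact.isBounded.subset_ball (0 : Eucl d)
    refine ⟨R, fun x hx => ?_⟩
    by_contra hne
    have := hR (subset_tsupport _ (Function.mem_support.2 hne))
    rw [mem_ball_zero_iff] at this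
    linarith
  rw [← sub_eq_zero, ← abs_nonpos_iff]
  refine le_of_forall_pos_le_add fun ε hε => ?_
  obtain ⟨δ, hδ, hfδ⟩ := Metric.uniformContinuous_iff.1
    (f.hasCompactSupport.uniformContinuous_of_continuous hf) (ε / 2) (by positivity)
  let ρ : ContDiffBump (0 : Eucl d) := ⟨δ / 4, δ / 2, by positivity, by linarith⟩
  have h1 : ∀ x, |mollify ρ f x - f x| ≤ ε / 2 := fun x =>
    abs_mollify_sub_le ρ hf fun y hy => by
      have : dist (x - y) x < δ := by
        rw [dist_eq_norm, sub_sub_cancel_left, norm_neg]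
        exact hy.trans_lt (by change δ / 2 < δ; linarith)
      exact (hfδ this).le
  have hzero : ∀ x, R + ρ.rOut ≤ ‖x‖ → mollify ρ f x = 0 := fun x hx => mollify_eq_zero ρ hf hR hx
  have hm := contDiff_mollify ρ hf
  obtain ⟨A, hA⟩ := ContDiff.lipschitzWith_of_hasCompactSupport
    (HasCompactSupport.intro (isCompact_closedBall (0 : Eucl d) (R + ρ.rOut)) fun x hx =>
      hzero x (by simpa using (lt_of_not_ge fun h => hx (by simpa using h)).le)) hm (by simp)
  have h2 := h A _ _ hA hzero
  have h3 : ∀ ξ : ProbCpt d, |∫ x, mollify ρ f x ∂ξ.toMeasure - ∫ x, f x ∂ξ.toMeasure| ≤ ε / 2 := by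
    intro ξ
    rw [← integral_sub (ξ.integrable_of_continuous hm.continuous) (ξ.integrable_of_continuous hf),
      ← Real.norm_eq_abs]
    simpa using norm_integral_le_of_norm_le_const (μ := ξ.toMeasure)
      (Eventually.of_forall fun x => (Real.norm_eq_abs _).trans_le (h1 x))
  have h4 := abs_le.1 (h3 μ)
  have h5 := abs_le.1 (h3 ν)
  rw [zero_add, abs_le]
  constructor <;> linarith [h4.1, h4.2, h5.1, h5.2]

/-! ### Uniqueness for the linear continuity equation -/

section LinearUniqueness

variable {d : ℕ} {T : ℝ}

/-- A `W₁`-continuous curve on a compact interval is uniformly continuous, in the dual form in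
which it is tested against Lipschitz functions. -/
theorem W1ContinuousOn.exists_abs_integral_sub_le {μ : ℝ → ProbCpt d} (hμ : W1ContinuousOn T μ)
    {ε : ℝ} (hε : 0 < ε) : ∃ δ > 0, ∀ s ∈ Icc 0 T, ∀ t ∈ Icc 0 T, |s - t| < δ →
      ∀ (Λ : ℝ≥0) (g : Eucl d → ℝ), LipschitzWith Λ g →
        |∫ x, g x ∂(μ s).toMeasure - ∫ x, g x ∂(μ t).toMeasure| ≤ Λ * ε := by
  have h : ∀ r : ℝ, ∃ η > 0, r ∈ Icc 0 T → ∀ s ∈ Icc 0 T, |s - r| < η →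
      (μ s).W1 (μ r) < ε / 2 := by
    intro r
    by_cases hr : r ∈ Icc 0 T
    · have := (hμ r hr).eventually (gt_mem_nhds (half_pos hε))
      rw [eventually_nhdsWithin_iff, Metric.eventually_nhds_iff] at this
      obtain ⟨η, hη, h⟩ := this
      exact ⟨η, hη, fun _ s hs hsr => h (by rwa [Real.dist_eq]) hs⟩
    · exact ⟨1, one_pos, fun h => absurd h hr⟩
  choose η hη h using h
  obtain ⟨δ, hδ, hcov⟩ := lebesgue_number_lemma_of_metric (isCompact_Icc (a := (0 : ℝ)) (b := T))
    (c := fun r : Icc 0 T => Metric.ball (r : ℝ) (η r)) (fun _ => Metric.isOpen_ball)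
    (fun r hr => mem_iUnion.2 ⟨⟨r, hr⟩, Metric.mem_ball_self (hη r)⟩)
  refine ⟨δ, hδ, fun s hs t ht hst Λ g hg => ?_⟩
  obtain ⟨r, hr⟩ := hcov t ht
  have h1 : ∀ s' ∈ Icc 0 T, |s' - t| < δ →
      |∫ x, g x ∂(μ s').toMeasure - ∫ x, g x ∂(μ r).toMeasure| ≤ Λ * (ε / 2) := by
    intro s' hs' hs't
    have h2 : s' ∈ Metric.ball (r : ℝ) (η r) := hr (by rwa [Metric.mem_ball, Real.dist_eq])
    rw [Metric.mem_ball, Real.dist_eq] at h2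
    exact ((μ s').abs_integral_sub_le (μ r) hg).trans
      (by gcongr; exact (h r r.2 s' hs' h2).le)
  have h2 := abs_le.1 (h1 s hs hst)
  have h3 := abs_le.1 (h1 t ht (by simpa using hδ))
  rw [abs_le]
  constructor <;> linarith [h2.1, h2.2, h3.1, h3.2]

theorem exists_norm_field_sub_le {b : ℝ → Eucl d → Eucl d}
    (hb : Continuous (Function.uncurry b)) (T R : ℝ) {ε : ℝ} (hε : 0 < ε) :
    ∃ δ > 0, ∀ s ∈ Icc 0 T, ∀ t ∈ Icc 0 T, |s - t| < δ → ∀ x, ‖x‖ ≤ R → ‖b s x - b t x‖ ≤ ε := by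
  have hu := ((isCompact_Icc (a := (0 : ℝ)) (b := T)).prod
    (isCompact_closedBall (0 : Eucl d) R)).uniformContinuousOn_of_continuous hb.continuousOn
  obtain ⟨δ, hδ, h⟩ := Metric.uniformContinuousOn_iff.1 hu ε hε
  refine ⟨δ, hδ, fun s hs t ht hst x hx => ?_⟩
  have hx' : x ∈ Metric.closedBall (0 : Eucl d) R := by simpa using hx
  have := h (s, x) ⟨hs, hx'⟩ (t, x) ⟨ht, hx'⟩ (by simpa [Prod.dist_eq, Real.dist_eq, hδ] using hst)
  rw [dist_eq_norm] at this
  exact this.le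

theorem fderiv_eq_zero_of_norm_gt {w : Eucl d → ℝ} {R : ℝ} (h : ∀ x, R ≤ ‖x‖ → w x = 0)
    {x : Eucl d} (hx : R < ‖x‖) : fderiv ℝ w x = 0 := by
  have : w =ᶠ[𝓝 x] fun _ => 0 := by
    filter_upwards [(isOpen_lt continuous_const continuous_norm).mem_nhds hx] with y hy
    exact h y (le_of_lt hy)
  rw [this.fderiv_eq]
  simp

theorem abs_taylor_le {w : Eucl d → ℝ} (hw : Differentiable ℝ w) {B : ℝ≥0}
    (hB : LipschitzWith B (fderiv ℝ w)) (x v : Eucl d) :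
    |w (x + v) - w x - fderiv ℝ w x v| ≤ B * ‖v‖ ^ 2 := by
  have h := (convex_closedBall x ‖v‖).norm_image_sub_le_of_norm_hasFDerivWithin_le'
    (f := w) (f' := fderiv ℝ w) (φ := fderiv ℝ w x) (C := B * ‖v‖) (x := x) (y := x + v)
    (fun y _ => (hw y).hasFDerivAt.hasFDerivWithinAt) (fun y hy => by
      have := hB.dist_le_mul y x
      rw [dist_eq_norm] at this
      exact this.trans (by gcongr; exact hy)) (by simp) (by simp)
  rw [add_sub_cancel_left, Real.norm_eq_abs] at h
  exact h.trans (by rw [sq, mul_assoc])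

/-- The pairing of the derivative of a test function with the velocity is Lipschitz, since the
velocity is bounded on the support of the test function. -/
theorem lipschitzWith_fderiv_apply {w : Eucl d → ℝ} {R A B M : ℝ≥0} {v : Eucl d → Eucl d}
    (hw0 : ∀ x, R ≤ ‖x‖ → w x = 0) (hA : ∀ x, ‖fderiv ℝ w x‖ ≤ A)
    (hB : LipschitzWith B (fderiv ℝ w)) (hv : LipschitzWith M v)
    (hvM : ∀ x, ‖v x‖ ≤ M * (1 + ‖x‖)) :
    LipschitzWith (B * (M * (1 + R)) + A * M) fun x => fderiv ℝ w x (v x) := by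
  -- it suffices to treat the case in which the first point lies in the support
  have key : ∀ x y : Eucl d, ‖x‖ ≤ R → |fderiv ℝ w x (v x) - fderiv ℝ w y (v y)|
      ≤ (B * (M * (1 + R)) + A * M) * dist x y := by
    intro x y hx
    have h1 : fderiv ℝ w x (v x) - fderiv ℝ w y (v y)
        = (fderiv ℝ w x - fderiv ℝ w y) (v x) + fderiv ℝ w y (v x - v y) := by
      simp
    have h2 := hB.dist_le_mul x y
    have h3 := hv.dist_le_mul x y
    rw [dist_eq_norm (fderiv ℝ w x)] at h2
    rw [dist_eq_norm (v x)] at h3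
    have h4 : ‖v x‖ ≤ M * (1 + R) := (hvM x).trans (by gcongr)
    rw [h1, ← Real.norm_eq_abs]
    calc _ ≤ ‖fderiv ℝ w x - fderiv ℝ w y‖ * ‖v x‖ + ‖fderiv ℝ w y‖ * ‖v x - v y‖ :=
          (norm_add_le _ _).trans (add_le_add (ContinuousLinearMap.le_opNorm _ _)
            (ContinuousLinearMap.le_opNorm _ _))
      _ ≤ (B * dist x y) * (M * (1 + R)) + A * (M * dist x y) := by
          gcongr
          exact hA y
      _ = _ := by ring
  refine LipschitzWith.of_dist_le_mul fun x y => ?_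
  push_cast
  rw [Real.dist_eq]
  by_cases hx : ‖x‖ ≤ R
  · exact key x y hx
  by_cases hy : ‖y‖ ≤ R
  · rw [abs_sub_comm, dist_comm]
    exact key y x hy
  · rw [fderiv_eq_zero_of_norm_gt hw0 (not_le.1 hx), fderiv_eq_zero_of_norm_gt hw0 (not_le.1 hy)]
    simp only [zero_apply, sub_zero, abs_zero]
    positivity

theorem one_add_norm_le_of_step {M h : ℝ} {x v : Eucl d} (hh : 0 ≤ h)
    (hv : ‖v‖ ≤ M * (1 + ‖x‖)) : (1 - h * M) * (1 + ‖x‖) ≤ 1 + ‖x + h • v‖ := by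
  have h1 : ‖x‖ ≤ ‖x + h • v‖ + ‖h • v‖ := by
    simpa using norm_sub_le (x + h • v) (h • v)
  rw [norm_smul, Real.norm_of_nonneg hh] at h1
  nlinarith [mul_le_mul_of_nonneg_left hv hh]

/-- Along a solution of the continuity equation, one explicit Euler step approximates the
evolution of a smooth test function `w` up to an error that is small compared with the step `h`,
uniformly for `w` in a set of functions with common support and common `C^{1,1}` bounds. -/
theorem IsContinuitySolution.euler_step {b : ℝ → Eucl d → Eucl d} {μ : ℝ → ProbCpt d}
    (hμ : IsContinuitySolution b T μ) (hb : Continuous (Function.uncurry b)) {M : ℝ≥0}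
    (hL : ∀ t, LipschitzWith M (b t)) (hM : ∀ t ∈ Icc 0 T, ∀ x, ‖b t x‖ ≤ M * (1 + ‖x‖))
    (R A B : ℝ≥0) {ε : ℝ} (hε : 0 < ε) :
    ∃ h₀ > 0, ∀ t h : ℝ, 0 ≤ t → 0 ≤ h → h < h₀ → t + h ≤ T → ∀ w : Eucl d → ℝ,
      ContDiff ℝ ∞ w → (∀ x, R ≤ ‖x‖ → w x = 0) → (∀ x, ‖fderiv ℝ w x‖ ≤ A) →
      LipschitzWith B (fderiv ℝ w) →
      |∫ x, w x ∂(μ (t + h)).toMeasure - ∫ x, w (x + h • b t x) ∂(μ t).toMeasure| ≤ ε * h := by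
  set Λ : ℝ≥0 := B * (M * (1 + R)) + A * M with hΛ
  obtain ⟨δ₁, hδ₁, H₁⟩ := exists_norm_field_sub_le hb T R (ε := ε / (3 * (A + 1))) (by positivity)
  obtain ⟨δ₂, hδ₂, H₂⟩ := hμ.continuous.exists_abs_integral_sub_le
    (ε := ε / (3 * (Λ + 1))) (by positivity)
  set Q : ℝ := B * (M * (2 * (1 + R))) ^ 2 with hQ
  have hQ0 : 0 ≤ Q := by positivity
  refine ⟨min (min δ₁ δ₂) (min (1 / (2 * (M + 1))) (ε / (3 * (Q + 1)))), by positivity, ?_⟩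
  intro t h ht hh hlt hT w hw hw0 hA hB
  obtain ⟨⟨hlt₁, hlt₂⟩, hlt₃, hlt₄⟩ : (h < δ₁ ∧ h < δ₂) ∧ h < 1 / (2 * ((M : ℝ) + 1)) ∧
      h < ε / (3 * (Q + 1)) := by simpa [lt_min_iff] using hlt
  rw [lt_div_iff₀ (by positivity)] at hlt₃ hlt₄
  have hhM : h * M ≤ 1 / 2 := by nlinarith
  have htT : t ∈ Icc 0 T := ⟨ht, by linarith⟩
  have hthT : t + h ∈ Icc 0 T := ⟨by linarith, hT⟩
  have hw' : HasCompactSupport w :=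
    HasCompactSupport.intro (isCompact_closedBall (0 : Eucl d) R) fun x hx =>
      hw0 x (by simpa using (lt_of_not_ge fun h => hx (by simpa using h)).le)
  have hbt : ∀ s, Continuous (b s) := fun s => (hL s).continuous
  have hDc : Continuous (fderiv ℝ w) := hw.continuous_fderiv (by simp)
  set J : ℝ → ℝ := fun s => ∫ x, fderiv ℝ w x (b s x) ∂(μ s).toMeasure with hJ
  have hJi : ∀ a ∈ Icc 0 T, ∀ c ∈ Icc 0 T, IntervalIntegrable J volume a c := fun a ha c hc =>
    (hμ.intervalIntegrable w hw hw').mono_set (by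
      rw [uIcc_of_le (ha.1.trans ha.2)]
      exact uIcc_subset_Icc ha hc)
  have hJb : ∀ s ∈ Icc t (t + h), |J s - J t| ≤ 2 * ε / 3 := by
    intro s hs
    have hsT : s ∈ Icc 0 T := ⟨by linarith [hs.1], by linarith [hs.2]⟩
    have hst : |s - t| ≤ h := by rw [abs_of_nonneg] <;> linarith [hs.1, hs.2]
    have i1 : ∀ r, Integrable (fun x => fderiv ℝ w x (b r x)) (μ s).toMeasure := fun r =>
      (μ s).integrable_of_continuous (hDc.clm_apply (hbt r))
    have e1 : |J s - ∫ x, fderiv ℝ w x (b t x) ∂(μ s).toMeasure| ≤ ε / 3 := by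
      rw [hJ, ← integral_sub (i1 s) (i1 t), ← Real.norm_eq_abs]
      refine (norm_integral_le_of_norm_le_const (C := ε / 3)
        (Eventually.of_forall fun x => ?_)).trans (by simp)
      rw [← map_sub]
      by_cases hx : ‖x‖ ≤ R
      · calc _ ≤ ‖fderiv ℝ w x‖ * ‖b s x - b t x‖ := ContinuousLinearMap.le_opNorm _ _
          _ ≤ A * (ε / (3 * (A + 1))) := by
            gcongr
            · exact hA x
            · exact H₁ s hsT t htT (hst.trans_lt hlt₁) x hx
          _ ≤ ε / 3 := by
            rw [mul_div_assoc', div_le_div_iff₀ (by positivity) (by positivity)]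
            nlinarith [NNReal.coe_nonneg A]
      · rw [fderiv_eq_zero_of_norm_gt hw0 (not_le.1 hx)]
        simp only [zero_apply, norm_zero]
        positivity
    have e2 : |∫ x, fderiv ℝ w x (b t x) ∂(μ s).toMeasure - J t| ≤ ε / 3 := by
      refine (H₂ s hsT t htT (hst.trans_lt hlt₂) Λ _
        (lipschitzWith_fderiv_apply hw0 hA hB (hL t) (hM t htT))).trans ?_
      rw [mul_div_assoc', div_le_div_iff₀ (by positivity) (by positivity)]
      nlinarith [NNReal.coe_nonneg Λ]
    have := abs_add_le (J s - ∫ x, fderiv ℝ w x (b t x) ∂(μ s).toMeasure)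
      (∫ x, fderiv ℝ w x (b t x) ∂(μ s).toMeasure - J t)
    rw [sub_add_sub_cancel] at this
    linarith
  have hfirst : |∫ x, w x ∂(μ (t + h)).toMeasure - ∫ x, w x ∂(μ t).toMeasure - h * J t|
      ≤ 2 * ε / 3 * h := by
    have h0 : (0 : ℝ) ∈ Icc 0 T := ⟨le_rfl, htT.1.trans htT.2⟩
    have e1 : ∫ x, w x ∂(μ (t + h)).toMeasure - ∫ x, w x ∂(μ t).toMeasure
        = ∫ s in t..(t + h), J s := by
      rw [hμ.weak w hw hw' _ hthT, hμ.weak w hw hw' _ htT, add_sub_add_left_eq_sub,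
        intervalIntegral.integral_interval_sub_left (hJi _ h0 _ hthT) (hJi _ h0 _ htT)]
    have e2 : ∫ s in t..(t + h), (J s - J t) = (∫ s in t..(t + h), J s) - h * J t := by
      rw [intervalIntegral.integral_sub (hJi _ htT _ hthT) (by simp)]
      simp
    rw [e1, ← e2, ← Real.norm_eq_abs]
    refine (intervalIntegral.norm_integral_le_of_norm_le_const (C := 2 * ε / 3)
      fun s hs => ?_).trans ?_
    · rw [uIoc_of_le (by linarith)] at hs
      exact hJb s (Ioc_subset_Icc_self hs)
    · rw [add_sub_cancel_left, abs_of_nonneg hh]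
  have hsecond : |∫ x, w (x + h • b t x) ∂(μ t).toMeasure - ∫ x, w x ∂(μ t).toMeasure - h * J t|
      ≤ ε / 3 * h := by
    have i1 : Integrable (fun x => w (x + h • b t x)) (μ t).toMeasure :=
      (μ t).integrable_of_continuous
        (hw.continuous.comp (continuous_id.add ((hbt t).const_smul h)))
    have i2 := (μ t).integrable_of_continuous hw.continuous
    have i3 : Integrable (fun x => h * fderiv ℝ w x (b t x)) (μ t).toMeasure :=
      ((μ t).integrable_of_continuous (hDc.clm_apply (hbt t))).const_mul h
    have i4 : Integrable (fun x => w (x + h • b t x) - w x) (μ t).toMeasure := i1.sub i2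
    rw [hJ, ← integral_const_mul, ← integral_sub i1 i2, ← integral_sub i4 i3,
      ← Real.norm_eq_abs]
    refine (norm_integral_le_of_norm_le_const (C := ε / 3 * h)
      (Eventually.of_forall fun x => ?_)).trans (by simp)
    rw [Real.norm_eq_abs]
    by_cases hx : ‖x‖ ≤ 1 + 2 * R
    · have e1 := abs_taylor_le (hw.differentiable (by simp)) hB x (h • b t x)
      rw [map_smul, smul_eq_mul] at e1
      refine e1.trans ?_
      have e2 : ‖b t x‖ ≤ M * (2 * (1 + R)) := (hM t htT x).trans (by gcongr; linarith)
      rw [norm_smul, Real.norm_of_nonneg hh]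
      calc (B : ℝ) * (h * ‖b t x‖) ^ 2 ≤ B * (h * (M * (2 * (1 + R)))) ^ 2 := by gcongr
        _ = (Q * h) * h := by rw [hQ]; ring
        _ ≤ ε / 3 * h := by
          gcongr
          nlinarith
    · -- far from the support of `w` neither the point nor its image meets the support
      have e1 := one_add_norm_le_of_step hh (hM t htT x)
      have hx' := not_le.1 hx
      have e2 : (R : ℝ) ≤ ‖x + h • b t x‖ := by nlinarith [norm_nonneg x]
      rw [hw0 _ e2, hw0 x (by linarith [NNReal.coe_nonneg R]),
        fderiv_eq_zero_of_norm_gt hw0 (by linarith [NNReal.coe_nonneg R])]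
      simp only [zero_apply, mul_zero, sub_zero, abs_zero]
      positivity
  have h1 := abs_le.1 hfirst
  have h2 := abs_le.1 hsecond
  rw [abs_le]
  constructor <;> linarith [h1.1, h1.2, h2.1, h2.2]

/-- Backward Euler scheme for the transport equation `∂_t u + b · ∇u = 0` with final value `φ` at
time `τ`: the function `eulerPullback b τ h φ j` approximates the solution at time `τ - j h`. -/
def eulerPullback (b : ℝ → Eucl d → Eucl d) (τ h : ℝ) (φ : Eucl d → ℝ) : ℕ → Eucl d → ℝ
  | 0 => φ
  | j + 1 => fun x => eulerPullback b τ h φ j (x + h • b (τ - (j + 1) * h) x)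

theorem LipschitzWith.coe_smul {v : Eucl d → Eucl d} {M : ℝ≥0} (hv : LipschitzWith M v)
    (h : ℝ≥0) : LipschitzWith (h * M) fun x => (h : ℝ) • v x := by
  refine LipschitzWith.of_dist_le_mul fun x y => ?_
  rw [dist_smul₀, Real.norm_of_nonneg (NNReal.coe_nonneg h), NNReal.coe_mul, mul_assoc]
  exact mul_le_mul_of_nonneg_left (hv.dist_le_mul x y) (NNReal.coe_nonneg h)

theorem lipschitzWith_eulerPullback {b : ℝ → Eucl d → Eucl d} {M : ℝ≥0}
    (hL : ∀ t, LipschitzWith M (b t)) {φ : Eucl d → ℝ} {A : ℝ≥0} (hφ : LipschitzWith A φ)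
    (τ : ℝ) (h : ℝ≥0) (j : ℕ) :
    LipschitzWith (A * (1 + h * M) ^ j) (eulerPullback b τ h φ j) := by
  induction j with
  | zero => simpa [eulerPullback] using hφ
  | succ j ih =>
    have h1 : LipschitzWith (1 + h * M) fun x => x + (h : ℝ) • b (τ - (j + 1) * h) x :=
      LipschitzWith.id.add ((hL _).coe_smul h)
    have h2 := ih.comp h1
    rw [mul_assoc, ← pow_succ] at h2
    exact h2

theorem exp_neg_two_mul_le {y : ℝ} (h0 : 0 ≤ y) (h1 : y ≤ 1 / 2) :
    Real.exp (-(2 * y)) ≤ 1 - y := by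
  rw [Real.exp_neg]
  refine inv_le_of_inv_le₀ (by linarith) ?_
  refine le_trans ?_ (Real.add_one_le_exp (2 * y))
  rw [inv_le_iff_one_le_mul₀ (by linarith)]
  nlinarith

/-- The support of the functions of the Euler scheme grows at most exponentially in time. -/
theorem eulerPullback_eq_zero {b : ℝ → Eucl d → Eucl d} {M : ℝ≥0} {τ h : ℝ}
    (hM : ∀ t ∈ Icc 0 T, ∀ x, ‖b t x‖ ≤ M * (1 + ‖x‖)) (hτ : τ ≤ T) (hh : 0 ≤ h)
    (hhM : h * M ≤ 1 / 2) {φ : Eucl d → ℝ} {R : ℝ} (hφ : ∀ x, R ≤ ‖x‖ → φ x = 0) {j : ℕ}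
    (hj : j * h ≤ τ) : ∀ x : Eucl d, (1 + R) * Real.exp (2 * M * (j * h)) ≤ 1 + ‖x‖ →
      eulerPullback b τ h φ j x = 0 := by
  induction j with
  | zero =>
    intro x hx
    simp only [Nat.cast_zero, zero_mul, mul_zero, Real.exp_zero, mul_one] at hx
    exact hφ x (by linarith)
  | succ j ih =>
    intro x hx
    push_cast at hx hj
    have h0 : 0 ≤ (j : ℝ) * h := by positivity
    refine ih (by linarith) _ ?_
    have h1 := one_add_norm_le_of_step hh
      (hM (τ - (j + 1) * h) ⟨by linarith, by linarith⟩ x)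
    refine le_trans ?_ h1
    have h2 := exp_neg_two_mul_le (by positivity) hhM
    calc (1 + R) * Real.exp (2 * M * (j * h))
        = Real.exp (-(2 * (h * M))) * ((1 + R) * Real.exp (2 * M * ((j + 1) * h))) := by
          rw [show 2 * (M : ℝ) * (j * h) = -(2 * (h * M)) + 2 * M * ((j + 1) * h) by ring,
            Real.exp_add]
          ring
      _ ≤ Real.exp (-(2 * (h * M))) * (1 + ‖x‖) := by gcongr
      _ ≤ (1 - h * M) * (1 + ‖x‖) := by gcongr

/-- Consistency of the scheme: along every solution of the continuity equation, the integral at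
time `0` of the mollified scheme approximates the integral at time `τ` of the mollified test
function. The error made by mollification is the commutator error `A M δ`, which is not divided by
the length of the steps. -/
theorem IsContinuitySolution.abs_integral_eulerPullback_sub_le {b : ℝ → Eucl d → Eucl d}
    {μ : ℝ → ProbCpt d} (hμ : IsContinuitySolution b T μ)
    (hb : Continuous (Function.uncurry b)) {M : ℝ≥0}
    (hL : ∀ t, LipschitzWith M (b t)) (hM : ∀ t ∈ Icc 0 T, ∀ x, ‖b t x‖ ≤ M * (1 + ‖x‖))
    {φ : Eucl d → ℝ} {A : ℝ≥0} (hφ : LipschitzWith A φ) {R : ℝ≥0}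
    (hφ0 : ∀ x, R ≤ ‖x‖ → φ x = 0) (ρ : ContDiffBump (0 : Eucl d)) {τ : ℝ} (hτ : τ ∈ Icc 0 T)
    {ε : ℝ} (hε : 0 < ε) :
    ∀ᶠ n : ℕ in atTop, |∫ x, mollify ρ (eulerPullback b τ (τ / n) φ n) x ∂(μ 0).toMeasure
      - ∫ x, mollify ρ φ x ∂(μ τ).toMeasure|
        ≤ τ * (ε + A * Real.exp (M * T) * M * ρ.rOut) := by
  set A' : ℝ≥0 := A * (Real.exp (M * T)).toNNReal with hA'
  have hA'c : (A' : ℝ) = A * Real.exp (M * T) := by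
    rw [hA', NNReal.coe_mul, Real.coe_toNNReal _ (Real.exp_pos _).le]
  set R' : ℝ≥0 := (1 + R) * (Real.exp (2 * M * T)).toNNReal + ρ.rOut.toNNReal with hR'
  have hR'c : (R' : ℝ) = (1 + R) * Real.exp (2 * M * T) + ρ.rOut := by
    rw [hR', NNReal.coe_add, NNReal.coe_mul, Real.coe_toNNReal _ (Real.exp_pos _).le,
      Real.coe_toNNReal _ ρ.rOut_pos.le]
    push_cast
    rfl
  obtain ⟨B, hB⟩ := exists_lipschitz_fderiv_mollify ρ
  obtain ⟨h₀, hh₀, hstep⟩ := hμ.euler_step hb hL hM R' A' (B * A') hε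
  have hlim : Tendsto (fun n : ℕ => τ / n) atTop (𝓝 0) := tendsto_const_div_atTop_nhds_zero_nat τ
  filter_upwards [hlim.eventually (gt_mem_nhds hh₀),
    hlim.eventually (gt_mem_nhds (show (0 : ℝ) < 1 / (2 * (M + 1)) by positivity)),
    eventually_gt_atTop 0] with n hn₀ hn₁ hn
  have hn' : (0 : ℝ) < n := by exact_mod_cast hn
  obtain ⟨h, hh⟩ : ∃ h : ℝ≥0, (h : ℝ) = τ / n := ⟨⟨τ / n, div_nonneg hτ.1 hn'.le⟩, rfl⟩
  rw [← hh] at hn₀ hn₁ ⊢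
  have hnh : n * (h : ℝ) = τ := by rw [hh]; field_simp
  rw [lt_div_iff₀ (by positivity)] at hn₁
  have hh0 := NNReal.coe_nonneg h
  have hhM : (h : ℝ) * M ≤ 1 / 2 := by nlinarith
  have hle : ∀ j ≤ n, (j : ℝ) * h ≤ τ := fun j hj => by
    rw [← hnh]; gcongr
  set U := eulerPullback b τ h φ with hU
  have hULip : ∀ j ≤ n, LipschitzWith A' (U j) := fun j hj => by
    refine (lipschitzWith_eulerPullback hL hφ τ h j).weaken ?_
    rw [← NNReal.coe_le_coe, hA'c]
    push_cast
    gcongr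
    calc (1 + (h : ℝ) * M) ^ j ≤ Real.exp (h * M) ^ j := by
          gcongr
          linarith [Real.add_one_le_exp ((h : ℝ) * M)]
      _ = Real.exp (M * (j * h)) := by rw [← Real.exp_nat_mul]; ring_nf
      _ ≤ Real.exp (M * T) := by
          gcongr
          exact (hle j hj).trans hτ.2
  have hU0 : ∀ j ≤ n, ∀ x, R' ≤ ‖x‖ → mollify ρ (U j) x = 0 := fun j hj x hx => by
    refine mollify_eq_zero ρ (hULip j hj).continuous
      (R := (1 + R) * Real.exp (2 * M * T)) (fun y hy => ?_) (by rwa [← hR'c])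
    refine eulerPullback_eq_zero hM hτ.2 hh0 hhM hφ0 (hle j hj) y ?_
    calc (1 + (R : ℝ)) * Real.exp (2 * M * (j * h)) ≤ (1 + R) * Real.exp (2 * M * T) := by
          gcongr
          exact (hle j hj).trans hτ.2
      _ ≤ 1 + ‖y‖ := by linarith
  have key : ∀ j ≤ n, |∫ x, mollify ρ (U j) x ∂(μ (τ - j * h)).toMeasure
      - ∫ x, mollify ρ φ x ∂(μ τ).toMeasure| ≤ (j * h) * (ε + A' * (M * ρ.rOut)) := by
    intro j
    induction j with
    | zero => intro _; simp [hU, eulerPullback]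
    | succ j ih =>
      intro hj
      have hj' : j ≤ n := by omega
      have ih := ih hj'
      have hjh := hle (j + 1) hj
      push_cast at hjh ⊢
      set t := τ - (j + 1) * h with ht
      have e0 : τ - j * (h : ℝ) = t + h := by rw [ht]; ring
      have hj0 : 0 ≤ (j : ℝ) * h := by positivity
      rw [e0] at ih
      have hLip := hULip j hj'
      have e1 := hstep t h (by linarith) hh0 hn₀ (by linarith [hτ.2]) (mollify ρ (U j))
        (contDiff_mollify ρ hLip.continuous) (hU0 j hj')
        (fun x => norm_fderiv_le_of_lipschitz ℝ (lipschitzWith_mollify ρ hLip)) (hB A' _ hLip)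
      have hv : LipschitzWith (h * M) fun x => (h : ℝ) • b t x := (hL t).coe_smul h
      have hm := (contDiff_mollify ρ hLip.continuous).continuous
      have hm' := (contDiff_mollify ρ (hULip (j + 1) hj).continuous).continuous
      have e2 : |∫ x, mollify ρ (U j) (x + (h : ℝ) • b t x) ∂(μ t).toMeasure
          - ∫ x, mollify ρ (U (j + 1)) x ∂(μ t).toMeasure| ≤ A' * (h * M * ρ.rOut) := by
        have i1 : Integrable (fun x => mollify ρ (U j) (x + (h : ℝ) • b t x)) (μ t).toMeasure :=
          (μ t).integrable_of_continuous (hm.comp (continuous_id.add hv.continuous))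
        rw [← integral_sub i1 ((μ t).integrable_of_continuous hm'), ← Real.norm_eq_abs]
        refine (norm_integral_le_of_norm_le_const (C := A' * (h * M * ρ.rOut))
          (Eventually.of_forall fun x => ?_)).trans (by simp)
        have := abs_mollify_comp_sub_le ρ hLip hv x
        push_cast at this
        exact this
      have e1' := abs_le.1 e1
      have e2' := abs_le.1 e2
      have e3' := abs_le.1 ih
      have e4 : ((j : ℝ) + 1) * h * (ε + A' * (M * ρ.rOut))
          = j * h * (ε + A' * (M * ρ.rOut)) + ε * h + A' * (h * M * ρ.rOut) := by ring
      rw [e4, abs_le]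
      constructor <;> linarith [e1'.1, e1'.2, e2'.1, e2'.2, e3'.1, e3'.2]
  have := key n le_rfl
  rw [hnh, sub_self, hA'c, ← mul_assoc] at this
  exact this

/-- Distributional solutions of the continuity equation with a Lipschitz velocity field are
determined by their initial value. -/
theorem IsContinuitySolution.eqOn {b : ℝ → Eucl d → Eucl d} {μ ν : ℝ → ProbCpt d}
    (hμ : IsContinuitySolution b T μ) (hν : IsContinuitySolution b T ν)
    (hb : Continuous (Function.uncurry b)) {L : ℝ≥0} (hL : ∀ t, LipschitzWith L (b t))
    (h0 : μ 0 = ν 0) : EqOn μ ν (Icc 0 T) := by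
  intro τ hτ
  obtain ⟨C, hC⟩ := (isCompact_Icc (a := (0 : ℝ)) (b := T)).exists_bound_of_continuousOn
    (f := fun t => b t 0)
    (hb.comp (by fun_prop : Continuous fun t : ℝ => (t, (0 : Eucl d)))).continuousOn
  set M : ℝ≥0 := L + C.toNNReal with hMdef
  have hLM : ∀ t, LipschitzWith M (b t) := fun t => (hL t).weaken le_self_add
  have hM : ∀ t ∈ Icc 0 T, ∀ x, ‖b t x‖ ≤ M * (1 + ‖x‖) := fun t ht x => by
    have h1 := (hL t).dist_le_mul x 0
    rw [dist_eq_norm, dist_zero_right] at h1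
    have h2 := (hC t ht).trans (Real.le_coe_toNNReal C)
    have h3 : ‖b t x‖ ≤ ‖b t x - b t 0‖ + ‖b t 0‖ := by
      simpa using norm_add_le (b t x - b t 0) (b t 0)
    rw [hMdef]
    push_cast
    nlinarith [norm_nonneg x, NNReal.coe_nonneg L, NNReal.coe_nonneg C.toNNReal,
      mul_nonneg (NNReal.coe_nonneg C.toNNReal) (norm_nonneg x)]
  refine ProbCpt.ext_of_lipschitz fun A R φ hφ hφ0 => ?_
  have hφ0' : ∀ x : Eucl d, R.toNNReal ≤ ‖x‖ → φ x = 0 := fun x hx =>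
    hφ0 x ((Real.le_coe_toNNReal R).trans hx)
  rw [← sub_eq_zero, ← abs_nonpos_iff]
  set D : ℝ := 2 * A + 2 * (τ * (A * Real.exp (M * T) * M)) with hD
  -- the error for a mollifier of radius `δ` and a tolerance `δ` in the scheme
  have key : ∀ δ : ℝ, 0 < δ → |∫ x, φ x ∂(μ τ).toMeasure - ∫ x, φ x ∂(ν τ).toMeasure|
      ≤ (D + 2 * τ) * δ := by
    intro δ hδ
    let ρ : ContDiffBump (0 : Eucl d) := ⟨δ / 2, δ, by positivity, by linarith⟩
    obtain ⟨n, hn₁, hn₂⟩ :=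
      ((hμ.abs_integral_eulerPullback_sub_le hb hLM hM hφ hφ0' ρ hτ hδ).and
        (hν.abs_integral_eulerPullback_sub_le hb hLM hM hφ hφ0' ρ hτ hδ)).exists
    rw [← h0] at hn₂
    have h3 : ∀ ξ : ProbCpt d,
        |∫ x, mollify ρ φ x ∂ξ.toMeasure - ∫ x, φ x ∂ξ.toMeasure| ≤ A * δ := by
      intro ξ
      rw [← integral_sub (ξ.integrable_of_continuous (contDiff_mollify ρ hφ.continuous).continuous)
        (ξ.integrable_of_continuous hφ.continuous), ← Real.norm_eq_abs]
      refine (norm_integral_le_of_norm_le_const (C := A * δ)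
        (Eventually.of_forall fun x => ?_)).trans (by simp)
      exact abs_mollify_sub_le_of_lipschitz ρ hφ x
    have e1 := abs_le.1 hn₁
    have e2 := abs_le.1 hn₂
    have e3 := abs_le.1 (h3 (μ τ))
    have e4 := abs_le.1 (h3 (ν τ))
    have e5 : (D + 2 * τ) * δ = 2 * (A * δ) + 2 * (τ * (δ + A * Real.exp (M * T) * M * δ)) := by
      rw [hD]; ring
    change _ ≤ τ * (δ + A * Real.exp (M * T) * M * δ) at hn₁ hn₂
    change -(τ * (δ + A * Real.exp (M * T) * M * δ)) ≤ _ ∧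
      _ ≤ τ * (δ + A * Real.exp (M * T) * M * δ) at e1 e2
    rw [e5, abs_le]
    constructor <;> linarith [e1.1, e1.2, e2.1, e2.2, e3.1, e3.2, e4.1, e4.2]
  have hlim : Tendsto (fun δ : ℝ => (D + 2 * τ) * δ) (𝓝[>] 0) (𝓝 0) := by
    have : Continuous fun δ : ℝ => (D + 2 * τ) * δ := by fun_prop
    simpa using (this.tendsto 0).mono_left nhdsWithin_le_nhds
  exact ge_of_tendsto hlim (by filter_upwards [self_mem_nhdsWithin] with δ hδ using key δ hδ)

end LinearUniqueness

/-! ### Well-posedness of the nonlocal equation -/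

section Vlasov

variable {d : ℕ} {V : ProbCpt d → ℝ → Eucl d → Eucl d} {T : ℝ} {L K : ℝ≥0}

theorem isVlasovSolution_iff (hT : 0 ≤ T) {μ₀ : ProbCpt d} {μ : ℝ → ProbCpt d} :
    IsVlasovSolution V T μ₀ μ ↔ μ 0 = μ₀ ∧ IsContinuitySolution (fieldAlong V hT μ) T μ := by
  have h1 : ∀ φ : Eucl d → ℝ, ∀ s ∈ Icc 0 T,
      ∫ x, fderiv ℝ φ x (fieldAlong V hT μ s x) ∂(μ s).toMeasure
        = ∫ x, fderiv ℝ φ x (V (μ s) s x) ∂(μ s).toMeasure := fun φ s hs => by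
    rw [fieldAlong_of_mem hT μ hs]
  have h2 : ∀ φ : Eucl d → ℝ,
      IntervalIntegrable (fun s => ∫ x, fderiv ℝ φ x (V (μ s) s x) ∂(μ s).toMeasure) volume 0 T ↔
      IntervalIntegrable
        (fun s => ∫ x, fderiv ℝ φ x (fieldAlong V hT μ s x) ∂(μ s).toMeasure) volume 0 T :=
    fun φ => intervalIntegrable_congr fun s hs => by
      rw [uIoc_of_le hT] at hs
      exact (h1 φ s (Ioc_subset_Icc_self hs)).symm
  have h3 : ∀ φ : Eucl d → ℝ, ∀ t ∈ Icc 0 T,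
      ∫ s in (0 : ℝ)..t, ∫ x, fderiv ℝ φ x (fieldAlong V hT μ s x) ∂(μ s).toMeasure
        = ∫ s in (0 : ℝ)..t, ∫ x, fderiv ℝ φ x (V (μ s) s x) ∂(μ s).toMeasure := fun φ t ht =>
    intervalIntegral.integral_congr fun s hs => by
      rw [uIcc_of_le ht.1] at hs
      exact h1 φ s ⟨hs.1, hs.2.trans ht.2⟩
  constructor
  · intro h
    refine ⟨h.initial, h.continuous, fun φ hφ hc => (h2 φ).1 (h.intervalIntegrable φ hφ hc),
      fun φ hφ hc t ht => ?_⟩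
    rw [h3 φ t ht, h.initial]
    exact h.weak φ hφ hc t ht
  · rintro ⟨h0, h⟩
    refine ⟨h0, h.continuous, fun φ hφ hc => (h2 φ).2 (h.intervalIntegrable φ hφ hc),
      fun φ hφ hc t ht => ?_⟩
    rw [← h3 φ t ht, ← h0]
    exact h.weak φ hφ hc t ht

/-- A compactly supported measure as the law of the inclusion of a compact set. -/
theorem ProbCpt.exists_pushCpt_val (μ : ProbCpt d) : ∃ (A : Set (Eucl d)) (_ : CompactSpace A)
    (P : Measure A) (_ : IsProbabilityMeasure P), pushCpt P ⟨Subtype.val, continuous_subtype_val⟩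
      = μ := by
  obtain ⟨A, hA, hμ⟩ := μ.2
  have hA' : CompactSpace A := isCompact_iff_compactSpace.1 hA
  have h : (μ.toMeasure.comap (Subtype.val : A → Eucl d)).map Subtype.val = μ.toMeasure := by
    rw [map_comap_subtype_coe hA.measurableSet]
    exact Measure.restrict_eq_self_of_ae_mem hμ
  have hP : IsProbabilityMeasure (μ.toMeasure.comap (Subtype.val : A → Eucl d)) := by
    constructor
    have := congrArg (fun m => m univ) h
    simpa [Measure.map_apply measurable_subtype_coe MeasurableSet.univ] using this
  exact ⟨A, hA', _, hP, ProbCpt.toMeasure_injective h⟩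

section Lagrangian

variable {S : Type*} [TopologicalSpace S] [CompactSpace S] [T2Space S] [MeasurableSpace S]
  [BorelSpace S] (P : Measure S) [IsProbabilityMeasure P]

theorem IsUniformField.isVlasovSolution_pushCpt (hV : IsUniformField V T L K) (hT : 0 ≤ T)
    {Y : ℝ → C(S, Eucl d)} (hY : ∀ t ∈ Icc 0 T, HasDerivWithinAt Y
      (fieldComp (V (pushCpt P (Y t))) (hV.continuous _) t (Y t)) (Icc 0 T) t) :
    IsVlasovSolution V T (pushCpt P (Y 0)) fun t => pushCpt P (Y t) := by
  have hYc : ContinuousOn Y (Icc 0 T) := fun t ht => (hY t ht).continuousWithinAt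
  refine (isVlasovSolution_iff hT).2 ⟨rfl, ?_⟩
  refine isContinuitySolution_pushCpt P hT
    (hV.continuous_fieldAlong hT (w1ContinuousOn_pushCpt P hYc)) fun t ht => ?_
  refine (hY t ht).congr_deriv ?_
  ext1 s
  exact (congrFun (fieldAlong_of_mem hT (fun t => pushCpt P (Y t)) ht) (Y t s)).symm

/-- Every solution of the nonlocal equation is transported by a flow that solves the
self-consistent Lagrangian equation: by uniqueness for the linear equation with the frozen field,
the solution is the push-forward by the flow of that field. -/
theorem IsUniformField.exists_lagrangian (hV : IsUniformField V T L K) (hT : 0 ≤ T)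
    {Y₀ : C(S, Eucl d)} {μ : ℝ → ProbCpt d} (hμ : IsVlasovSolution V T (pushCpt P Y₀) μ) :
    ∃ Y : ℝ → C(S, Eucl d), Y 0 = Y₀ ∧ (∀ t ∈ Icc 0 T, HasDerivWithinAt Y
      (fieldComp (V (pushCpt P (Y t))) (hV.continuous _) t (Y t)) (Icc 0 T) t) ∧
      ∀ t ∈ Icc 0 T, μ t = pushCpt P (Y t) := by
  obtain ⟨h0, hμ'⟩ := (isVlasovSolution_iff hT).1 hμ
  have hb := hV.continuous_fieldAlong hT hμ'.continuous
  obtain ⟨Y, hY0, hY⟩ := exists_solution_of_lipschitz (f := fieldComp (fieldAlong V hT μ) hb)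
    (fun t => lipschitzWith_fieldComp hb (hV.lipschitzWith_fieldAlong hT μ t))
    (continuous_fieldComp _ hb) T Y₀
  have heq : EqOn μ (fun t => pushCpt P (Y t)) (Icc 0 T) :=
    hμ'.eqOn (isContinuitySolution_pushCpt P hT hb hY) hb (hV.lipschitzWith_fieldAlong hT μ)
      (by rw [h0, hY0])
  refine ⟨Y, hY0, fun t ht => (hY t ht).congr_deriv ?_, heq⟩
  have h1 : pushCpt P (Y t) = μ t := (heq ht).symm
  ext1 s
  change fieldAlong V hT μ t (Y t s) = V (pushCpt P (Y t)) t (Y t s)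
  rw [h1, fieldAlong_of_mem hT μ ht]

end Lagrangian

theorem IsUniformField.exists_isVlasovSolution (hV : IsUniformField V T L K) (hT : 0 ≤ T)
    (μ₀ : ProbCpt d) : ∃ μ, IsVlasovSolution V T μ₀ μ := by
  obtain ⟨A, _, P, _, rfl⟩ := μ₀.exists_pushCpt_val
  obtain ⟨Y, hY0, hY⟩ := hV.exists_selfConsistent_flow P hT ⟨Subtype.val, continuous_subtype_val⟩
  have := hV.isVlasovSolution_pushCpt P hT hY
  rw [hY0] at this
  exact ⟨_, this⟩

theorem IsUniformField.eqOn_of_isVlasovSolution (hV : IsUniformField V T L K) (hT : 0 ≤ T)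
    {μ₀ : ProbCpt d} {μ ν : ℝ → ProbCpt d} (hμ : IsVlasovSolution V T μ₀ μ)
    (hν : IsVlasovSolution V T μ₀ ν) : EqOn μ ν (Icc 0 T) := by
  obtain ⟨A, _, P, _, rfl⟩ := μ₀.exists_pushCpt_val
  obtain ⟨Y, hY0, hY, hμY⟩ := hV.exists_lagrangian P hT hμ
  obtain ⟨Z, hZ0, hZ, hνZ⟩ := hV.exists_lagrangian P hT hν
  have hYZ : EqOn Y Z (Icc 0 T) := eqOn_of_lipschitz
    (f := fun t Y => fieldComp (V (pushCpt P Y)) (hV.continuous _) t Y)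
    (fun t ht => hV.lipschitzWith_selfConsistent P ht) hY hZ (by rw [hY0, hZ0])
  intro t ht
  rw [hμY t ht, hνZ t ht, hYZ ht]

theorem IsUniformField.isVlasovSolution_vlasovSolution (hV : IsUniformField V T L K) (hT : 0 ≤ T)
    (μ₀ : ProbCpt d) : IsVlasovSolution V T μ₀ (vlasovSolution V T μ₀) :=
  Classical.epsilon_spec (hV.exists_isVlasovSolution hT μ₀)

/-! ### Characteristics -/

theorem IsUniformField.exists_isCharacteristic (hV : IsUniformField V T L K) (hT : 0 ≤ T)
    (μ₀ : ProbCpt d) (x : Eucl d) : ∃ γ, IsCharacteristic V T μ₀ x γ := by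
  have hb := hV.continuous_fieldAlong hT
    ((isVlasovSolution_iff hT).1 (hV.isVlasovSolution_vlasovSolution hT μ₀)).2.continuous
  obtain ⟨γ, h0, hγ⟩ := exists_solution_of_lipschitz
    (hV.lipschitzWith_fieldAlong hT (vlasovSolution V T μ₀))
    (fun x => hb.comp (by fun_prop : Continuous fun t : ℝ => (t, x))) T x
  refine ⟨γ, h0, fun t ht => ?_⟩
  have := hγ t ht
  rwa [fieldAlong_of_mem hT _ ht] at this

theorem IsUniformField.eqOn_of_isCharacteristic (hV : IsUniformField V T L K) {μ₀ : ProbCpt d}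
    {x : Eucl d} {γ γ' : ℝ → Eucl d} (hγ : IsCharacteristic V T μ₀ x γ)
    (hγ' : IsCharacteristic V T μ₀ x γ') : EqOn γ γ' (Icc 0 T) :=
  eqOn_of_lipschitz (f := fun t => V (vlasovSolution V T μ₀ t) t)
    (fun t ht => hV.lipschitz_space t ht _) hγ.ode hγ'.ode (by rw [hγ.initial, hγ'.initial])

/-- The characteristic that starts at `x`; its value at the time `T` is `flowMap V T μ₀ x`. -/
def characteristic (V : ProbCpt d → ℝ → Eucl d → Eucl d) (T : ℝ) (μ₀ : ProbCpt d)
    (x : Eucl d) : ℝ → Eucl d :=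
  Classical.epsilon (IsCharacteristic V T μ₀ x)

theorem IsUniformField.isCharacteristic_characteristic (hV : IsUniformField V T L K) (hT : 0 ≤ T)
    (μ₀ : ProbCpt d) (x : Eucl d) : IsCharacteristic V T μ₀ x (characteristic V T μ₀ x) :=
  Classical.epsilon_spec (hV.exists_isCharacteristic hT μ₀ x)

/-- Two characteristics along two solutions whose `W₁` distance is at most `Θ e^{λ t}` satisfy the
same kind of bound, with `Θ` replaced by `q + Θ / 2`. The rate `λ = L + 2 K + 1` is chosen so
large that the dependence on the measure contributes at most half of the bound. -/
theorem IsUniformField.norm_characteristic_sub_le (hV : IsUniformField V T L K)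
    {μ₀ ν₀ : ProbCpt d} {x y : Eucl d} {α β : ℝ → Eucl d} (hα : IsCharacteristic V T μ₀ x α)
    (hβ : IsCharacteristic V T ν₀ y β) {Θ q : ℝ} (hΘ0 : 0 ≤ Θ)
    (hΘ : ∀ t ∈ Icc 0 T, (vlasovSolution V T μ₀ t).W1 (vlasovSolution V T ν₀ t)
      ≤ Θ * Real.exp ((L + 2 * K + 1) * t))
    (hq0 : 0 < q) (hq : ‖x - y‖ ≤ q) {t : ℝ} (ht : t ∈ Icc 0 T) :
    ‖α t - β t‖ ≤ (q + Θ / 2) * Real.exp ((L + 2 * K + 1) * t) := by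
  set lam : ℝ := L + 2 * K + 1 with hlam
  have hL0 := NNReal.coe_nonneg L
  have hK0 := NNReal.coe_nonneg K
  have hd : ∀ s : ℝ, HasDerivAt (fun s => (q + Θ / 2) * Real.exp (lam * s))
      ((q + Θ / 2) * (Real.exp (lam * s) * lam)) s := fun s => by
    have h1 : HasDerivAt (fun s : ℝ => lam * s) lam s := by
      simpa using (hasDerivAt_id s).const_mul lam
    exact h1.exp.const_mul _
  refine image_norm_le_of_norm_deriv_right_lt_deriv_boundary (f := fun s => α s - β s)
    (f' := fun s => V (vlasovSolution V T μ₀ s) s (α s) - V (vlasovSolution V T ν₀ s) s (β s))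
    (fun s hs => ((hα.ode s hs).sub (hβ.ode s hs)).continuousWithinAt)
    (fun s hs => ((hα.ode s (Ico_subset_Icc_self hs)).sub
      (hβ.ode s (Ico_subset_Icc_self hs))).Ici_of_Icc hs) ?_ hd (fun s hs hB => ?_) ht
  · rw [hα.initial, hβ.initial]
    simp only [mul_zero, Real.exp_zero, mul_one]
    linarith
  · have hs' := Ico_subset_Icc_self hs
    have h1 := (hV.lipschitz_space s hs' (vlasovSolution V T μ₀ s)).dist_le_mul (α s) (β s)
    rw [dist_eq_norm, dist_eq_norm, hB] at h1
    have h2 := (hV.lipschitz_measure s hs' (vlasovSolution V T μ₀ s)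
      (vlasovSolution V T ν₀ s) (β s)).trans (mul_le_mul_of_nonneg_left (hΘ s hs') hK0)
    have h3 := norm_sub_le_norm_sub_add_norm_sub (V (vlasovSolution V T μ₀ s) s (α s))
      (V (vlasovSolution V T μ₀ s) s (β s)) (V (vlasovSolution V T ν₀ s) s (β s))
    have hE := Real.exp_pos (lam * s)
    have h4 : (q + Θ / 2) * (Real.exp (lam * s) * lam)
        = L * ((q + Θ / 2) * Real.exp (lam * s)) + K * (Θ * Real.exp (lam * s))
          + (2 * K * q + q + Θ / 2) * Real.exp (lam * s) := by
      rw [hlam]; ring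
    have h5 : 0 < (2 * K * q + q + Θ / 2) * Real.exp (lam * s) := by positivity
    linarith

theorem IsUniformField.lipschitzWith_characteristic (hV : IsUniformField V T L K) (hT : 0 ≤ T)
    (μ₀ : ProbCpt d) {t : ℝ} (ht : t ∈ Icc 0 T) :
    LipschitzWith (Real.exp (L * t)).toNNReal fun x => characteristic V T μ₀ x t := by
  refine LipschitzWith.of_dist_le_mul fun x y => ?_
  have hx := hV.isCharacteristic_characteristic hT μ₀ x
  have hy := hV.isCharacteristic_characteristic hT μ₀ y
  have h := dist_le_of_trajectories_ODE_of_mem (s := fun _ => univ) (δ := dist x y)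
    (v := fun t => V (vlasovSolution V T μ₀ t) t)
    (fun s hs => (hV.lipschitz_space s (Ico_subset_Icc_self hs) _).lipschitzOnWith)
    (fun s hs => (hx.ode s hs).continuousWithinAt)
    (fun s hs => (hx.ode s (Ico_subset_Icc_self hs)).Ici_of_Icc hs) (fun _ _ => mem_univ _)
    (fun s hs => (hy.ode s hs).continuousWithinAt)
    (fun s hs => (hy.ode s (Ico_subset_Icc_self hs)).Ici_of_Icc hs) (fun _ _ => mem_univ _)
    (by rw [hx.initial, hy.initial]) t ht
  rwa [sub_zero, mul_comm, ← Real.coe_toNNReal _ (Real.exp_pos (L * t)).le] at h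

/-- The solution at time `t` is the image of the initial value by the flow of characteristics. -/
theorem IsUniformField.toMeasure_vlasovSolution (hV : IsUniformField V T L K) (hT : 0 ≤ T)
    (μ₀ : ProbCpt d) {t : ℝ} (ht : t ∈ Icc 0 T) :
    (vlasovSolution V T μ₀ t).toMeasure
      = μ₀.toMeasure.map fun x => characteristic V T μ₀ x t := by
  obtain ⟨A, _, P, _, hP⟩ := μ₀.exists_pushCpt_val
  have hsol : IsVlasovSolution V T (pushCpt P ⟨Subtype.val, continuous_subtype_val⟩)
      (vlasovSolution V T μ₀) := by
    rw [hP]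
    exact hV.isVlasovSolution_vlasovSolution hT μ₀
  obtain ⟨Y, hY0, hY, hμY⟩ := hV.exists_lagrangian P hT hsol
  have hchar : ∀ a : A, Y t a = characteristic V T μ₀ a t := fun a => by
    have : IsCharacteristic V T μ₀ a fun s => Y s a := by
      refine ⟨by simp [hY0], fun s hs => ?_⟩
      have h1 := hasDerivWithinAt_apply (hY s hs) a
      rw [hμY s hs]
      exact h1
    exact hV.eqOn_of_isCharacteristic this (hV.isCharacteristic_characteristic hT μ₀ a) ht
  have hm : Measurable fun x => characteristic V T μ₀ x t :=
    (hV.lipschitzWith_characteristic hT μ₀ ht).continuous.measurable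
  have hμ₀ : μ₀.toMeasure = P.map Subtype.val := by rw [← hP]; rfl
  rw [hμY t ht, toMeasure_pushCpt, hμ₀, Measure.map_map hm measurable_subtype_coe]
  congr 1
  funext a
  exact hchar a

theorem W1_pushCpt_le_norm_add_norm {S S' : Type*} [TopologicalSpace S] [CompactSpace S]
    [MeasurableSpace S] [BorelSpace S] [TopologicalSpace S'] [CompactSpace S'] [MeasurableSpace S']
    [BorelSpace S'] (P : Measure S) [IsProbabilityMeasure P] (Q : Measure S')
    [IsProbabilityMeasure Q] (Y : C(S, Eucl d)) (Z : C(S', Eucl d)) :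
    (pushCpt P Y).W1 (pushCpt Q Z) ≤ ‖Y‖ + ‖Z‖ := by
  refine ENNReal.toReal_le_of_le_ofReal (by positivity) ?_
  have h := wass_map_le (P.prod Q) (f := fun p => Y p.1) (g := fun p => Z p.2)
    (Y.continuous.measurable.comp measurable_fst) (Z.continuous.measurable.comp measurable_snd)
  have e1 : (P.prod Q).map (fun p => Y p.1) = P.map Y := by
    rw [show (fun p : S × S' => Y p.1) = Y ∘ Prod.fst from rfl,
      ← Measure.map_map Y.continuous.measurable measurable_fst]
    simp
  have e2 : (P.prod Q).map (fun p => Z p.2) = Q.map Z := by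
    rw [show (fun p : S × S' => Z p.2) = Z ∘ Prod.snd from rfl,
      ← Measure.map_map Z.continuous.measurable measurable_snd]
    simp
  rw [e1, e2] at h
  refine h.trans ?_
  calc ∫⁻ p, edist (Y p.1) (Z p.2) ∂(P.prod Q)
      ≤ ∫⁻ _, ENNReal.ofReal (‖Y‖ + ‖Z‖) ∂(P.prod Q) := by
        refine lintegral_mono fun p => ?_
        rw [edist_dist]
        refine ENNReal.ofReal_le_ofReal ((dist_le_norm_add_norm _ _).trans ?_)
        gcongr <;> exact ContinuousMap.norm_coe_le_norm _ _
    _ = _ := by simp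

/-- A solution is represented by maps that are bounded uniformly in time, so that its supports stay in
a fixed ball. -/
theorem IsUniformField.exists_norm_le (hV : IsUniformField V T L K) (hT : 0 ≤ T)
    (μ₀ : ProbCpt d) : ∃ (A : Set (Eucl d)) (_ : CompactSpace A) (P : Measure A)
      (_ : IsProbabilityMeasure P) (C : ℝ), ∀ t ∈ Icc 0 T, ∃ Y : C(A, Eucl d),
        ‖Y‖ ≤ C ∧ vlasovSolution V T μ₀ t = pushCpt P Y := by
  obtain ⟨A, hA, P, hP', hP⟩ := μ₀.exists_pushCpt_val
  have hsol : IsVlasovSolution V T (pushCpt P ⟨Subtype.val, continuous_subtype_val⟩)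
      (vlasovSolution V T μ₀) := by
    rw [hP]
    exact hV.isVlasovSolution_vlasovSolution hT μ₀
  obtain ⟨Y, -, hY, hμY⟩ := hV.exists_lagrangian P hT hsol
  obtain ⟨C, hC⟩ := (isCompact_Icc (a := (0 : ℝ)) (b := T)).exists_bound_of_continuousOn
    (f := Y) fun t ht => (hY t ht).continuousWithinAt
  exact ⟨A, hA, P, hP', C, fun t ht => ⟨Y t, hC t ht, hμY t ht⟩⟩

/-- Stability of the solutions in the distance `W₁`. -/
theorem IsUniformField.W1_vlasovSolution_le (hV : IsUniformField V T L K) (hT : 0 ≤ T)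
    (μ₀ ν₀ : ProbCpt d) {t : ℝ} (ht : t ∈ Icc 0 T) :
    (vlasovSolution V T μ₀ t).W1 (vlasovSolution V T ν₀ t)
      ≤ 2 * μ₀.W1 ν₀ * Real.exp ((L + 2 * K + 1) * t) := by
  set lam : ℝ := L + 2 * K + 1 with hlam
  have hlam0 : 0 ≤ lam := by positivity
  obtain ⟨A, _, P, _, C, hC⟩ := hV.exists_norm_le hT μ₀
  obtain ⟨A', _, P', _, C', hC'⟩ := hV.exists_norm_le hT ν₀
  set w : Icc (0 : ℝ) T → ℝ := fun s =>
    (vlasovSolution V T μ₀ s).W1 (vlasovSolution V T ν₀ s) / Real.exp (lam * s) with hw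
  have hbdd : BddAbove (range w) := by
    refine ⟨C + C', ?_⟩
    rintro _ ⟨s, rfl⟩
    obtain ⟨Y, hY, hYμ⟩ := hC s s.2
    obtain ⟨Z, hZ, hZν⟩ := hC' s s.2
    have h1 := W1_pushCpt_le_norm_add_norm P P' Y Z
    rw [← hYμ, ← hZν] at h1
    refine (div_le_self (ProbCpt.W1_nonneg _ _)
      (Real.one_le_exp (mul_nonneg hlam0 s.2.1))).trans ?_
    linarith
  have : Nonempty (Icc (0 : ℝ) T) := ⟨⟨0, le_rfl, hT⟩⟩
  set Θ := ⨆ s, w s with hΘ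
  have hwΘ : ∀ s ∈ Icc 0 T, (vlasovSolution V T μ₀ s).W1 (vlasovSolution V T ν₀ s)
      ≤ Θ * Real.exp (lam * s) := fun s hs => by
    have := le_ciSup hbdd ⟨s, hs⟩
    rwa [hw, div_le_iff₀ (Real.exp_pos _)] at this
  have hΘ0 : 0 ≤ Θ := by
    refine le_trans ?_ (le_ciSup hbdd ⟨0, le_rfl, hT⟩)
    exact div_nonneg (ProbCpt.W1_nonneg _ _) (Real.exp_pos _).le
  -- the bound with the constant `Θ` improves itself when integrated over a coupling
  have hhalf : Θ ≤ μ₀.W1 ν₀ + Θ / 2 := by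
    refine le_of_forall_pos_le_add fun ε hε => ciSup_le fun s => ?_
    rw [hw, div_le_iff₀ (Real.exp_pos _)]
    have hW0 := μ₀.W1_nonneg ν₀
    obtain ⟨π, h1, h2, h3⟩ := μ₀.exists_coupling ν₀ (half_pos hε)
    have hπ : π univ = 1 := by
      have := congrArg (fun m => m univ) h1
      simpa [Measure.map_apply measurable_fst MeasurableSet.univ] using this
    have hmX : Measurable fun x => characteristic V T μ₀ x s :=
      (hV.lipschitzWith_characteristic hT μ₀ s.2).continuous.measurable
    have hmZ : Measurable fun x => characteristic V T ν₀ x s :=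
      (hV.lipschitzWith_characteristic hT ν₀ s.2).continuous.measurable
    have hle := wass_map_le π (hmX.comp measurable_fst) (hmZ.comp measurable_snd)
    rw [← Measure.map_map hmX measurable_fst, ← Measure.map_map hmZ measurable_snd, h1, h2,
      ← hV.toMeasure_vlasovSolution hT μ₀ s.2, ← hV.toMeasure_vlasovSolution hT ν₀ s.2] at hle
    refine ENNReal.toReal_le_of_le_ofReal (by positivity) (hle.trans ?_)
    calc ∫⁻ p, edist (characteristic V T μ₀ p.1 s) (characteristic V T ν₀ p.2 s) ∂π
        ≤ ∫⁻ p, (edist p.1 p.2 + ENNReal.ofReal (ε / 2 + Θ / 2))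
            * ENNReal.ofReal (Real.exp (lam * s)) ∂π := by
          refine lintegral_mono fun p => ?_
          have h4 := hV.norm_characteristic_sub_le
            (hV.isCharacteristic_characteristic hT μ₀ p.1)
            (hV.isCharacteristic_characteristic hT ν₀ p.2) hΘ0 hwΘ
            (q := ‖p.1 - p.2‖ + ε / 2) (by positivity) (by linarith) s.2
          rw [edist_dist, edist_dist, ← ENNReal.ofReal_add dist_nonneg (by positivity),
            ← ENNReal.ofReal_mul (by positivity), dist_eq_norm, dist_eq_norm]
          refine ENNReal.ofReal_le_ofReal (h4.trans (le_of_eq ?_))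
          ring
      _ = (∫⁻ p, edist p.1 p.2 ∂π + ENNReal.ofReal (ε / 2 + Θ / 2))
            * ENNReal.ofReal (Real.exp (lam * s)) := by
          rw [lintegral_mul_const _ (by fun_prop), lintegral_add_right _ (by fun_prop),
            lintegral_const, hπ, mul_one]
      _ ≤ (ENNReal.ofReal (μ₀.W1 ν₀ + ε / 2) + ENNReal.ofReal (ε / 2 + Θ / 2))
            * ENNReal.ofReal (Real.exp (lam * s)) := by gcongr
      _ = ENNReal.ofReal ((μ₀.W1 ν₀ + Θ / 2 + ε) * Real.exp (lam * s)) := by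
          rw [← ENNReal.ofReal_add (by positivity) (by positivity),
            ← ENNReal.ofReal_mul (by positivity)]
          congr 1
          ring
  refine (hwΘ t ht).trans ?_
  gcongr
  linarith

theorem IsUniformField.norm_flowMap_sub_le (hV : IsUniformField V T L K) (hT : 0 ≤ T)
    (μ₀ ν₀ : ProbCpt d) (x y : Eucl d) :
    ‖flowMap V T μ₀ x - flowMap V T ν₀ y‖
      ≤ Real.exp ((L + 2 * K + 1) * T) * (μ₀.W1 ν₀ + ‖x - y‖) := by
  have hE := Real.exp_pos ((L + 2 * K + 1) * T)
  refine le_of_forall_pos_le_add fun ε hε => ?_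
  have h := hV.norm_characteristic_sub_le (hV.isCharacteristic_characteristic hT μ₀ x)
    (hV.isCharacteristic_characteristic hT ν₀ y)
    (mul_nonneg zero_le_two (μ₀.W1_nonneg ν₀)) (fun t ht => hV.W1_vlasovSolution_le hT μ₀ ν₀ ht)
    (q := ‖x - y‖ + ε / Real.exp ((L + 2 * K + 1) * T)) (by positivity)
    (by linarith [div_pos hε hE]) ⟨hT, le_rfl⟩
  refine h.trans (le_of_eq ?_)
  field_simp
  ring

end Vlasov

/-! ### Perturbations of positive measures -/

namespace PosMeas

variable {d : ℕ} {Ω : Set (Eucl d)}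

theorem mass_ne_zero (μ : PosMeas Ω) : μ.mass ≠ 0 := fun h =>
  μ.2.1 ((FiniteMeasure.mass_zero_iff _).1 h)

theorem mass_smul_normalize (μ : PosMeas Ω) :
    μ.mass • (μ.normalize : Measure (Eucl d)) = μ.toMeasure := by
  have h : (μ.normalize : Measure (Eucl d)) = μ.mass⁻¹ • μ.toMeasure :=
    μ.1.toMeasure_normalize_eq_of_nonzero μ.2.1
  rw [h, smul_smul, mul_inv_cancel₀ μ.mass_ne_zero, one_smul]

theorem W1_eq (hΩ : IsCompact Ω) (μ ν : PosMeas Ω) :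
    μ.W1 ν = (μ.toProbCpt hΩ).W1 (ν.toProbCpt hΩ) + |(μ.mass : ℝ) - ν.mass| := rfl

theorem W1_toProbCpt_le (hΩ : IsCompact Ω) (μ ν : PosMeas Ω) :
    (μ.toProbCpt hΩ).W1 (ν.toProbCpt hΩ) ≤ μ.W1 ν := by
  rw [W1_eq hΩ]
  linarith [abs_nonneg ((μ.mass : ℝ) - ν.mass)]

theorem ae_mem (μ : PosMeas Ω) : ∀ᵐ x ∂μ.toMeasure, x ∈ Ω := μ.2.2

instance (μ : PosMeas Ω) : IsFiniteMeasure μ.toMeasure := by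
  unfold toMeasure; infer_instance

theorem integrable_of_continuous (hΩ : IsCompact Ω) (μ : PosMeas Ω) {g : Eucl d → ℝ}
    (hg : Continuous g) : Integrable g μ.toMeasure := by
  have h : IntegrableOn g Ω μ.toMeasure := hg.continuousOn.integrableOn_compact hΩ
  rwa [IntegrableOn, Measure.restrict_eq_self_of_ae_mem μ.ae_mem] at h

theorem mass_addDirac (hΩ : MeasurableSet Ω) (μ : PosMeas Ω) (x : Ω) (ε : ℝ≥0) :
    (μ.addDirac hΩ x ε).mass = μ.mass + ε := by
  change (μ.1 + ε • pointMass (x : Eucl d)) univ = μ.1 univ + ε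
  have h : pointMass (x : Eucl d) univ = 1 := by
    rw [← ENNReal.coe_inj, FiniteMeasure.ennreal_coeFn_eq_coeFn_toMeasure]
    change Measure.dirac (x : Eucl d) univ = _
    simp
  rw [FiniteMeasure.coeFn_add, Pi.add_apply, FiniteMeasure.coeFn_smul, Pi.smul_apply, h,
    smul_eq_mul, mul_one]

theorem toMeasure_addDirac (hΩ : MeasurableSet Ω) (μ : PosMeas Ω) (x : Ω) (ε : ℝ≥0) :
    (μ.addDirac hΩ x ε).toMeasure = μ.toMeasure + ε • Measure.dirac (x : Eucl d) := by
  change ((μ.1 + ε • pointMass (x : Eucl d) : FiniteMeasure (Eucl d)) : Measure (Eucl d)) = _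
  rw [FiniteMeasure.toMeasure_add, FiniteMeasure.toMeasure_smul]
  rfl

/-- Adding a mass `ε` at a point of `Ω` changes a measure by `O(ε)` in the distance `W₁`: the
added mass is coupled with the normalized measure. -/
theorem exists_W1_addDirac_le (hΩ : IsCompact Ω) (μ : PosMeas Ω) (x : Ω) :
    ∃ C : ℝ, ∀ ε : ℝ≥0, (μ.addDirac hΩ.measurableSet x ε).W1 μ ≤ C * ε := by
  set ν : Measure (Eucl d) := (μ.normalize : Measure (Eucl d)) with hν
  set s := μ.mass with hs
  have hs0 : s ≠ 0 := μ.mass_ne_zero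
  have hs0' : (0 : ℝ) < s := by positivity
  have hμν : s • ν = μ.toMeasure := μ.mass_smul_normalize
  have hD := hΩ.isBounded.ediam_ne_top
  set D := (Metric.ediam Ω).toNNReal with hDdef
  refine ⟨D / s + 1, fun ε => ?_⟩
  set c := s + ε with hc
  have hc0 : c ≠ 0 := by positivity
  have hα : ((μ.addDirac hΩ.measurableSet x ε).normalize : Measure (Eucl d))
      = c⁻¹ • (s • ν + ε • Measure.dirac (x : Eucl d)) := by
    have h := (μ.addDirac hΩ.measurableSet x ε).mass_smul_normalize
    rw [mass_addDirac, toMeasure_addDirac, ← hμν, ← hs, ← hc] at h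
    rw [← h, smul_smul, inv_mul_cancel₀ hc0, one_smul]
  set π : Measure (Eucl d × Eucl d) := c⁻¹ • (s • ν.map (fun z => (z, z))
    + ε • ν.map (fun z => ((x : Eucl d), z))) with hπ
  have m1 : Measurable fun z : Eucl d => (z, z) := by fun_prop
  have m2 : Measurable fun z : Eucl d => ((x : Eucl d), z) := by fun_prop
  have h1 : π.map Prod.fst = ((μ.addDirac hΩ.measurableSet x ε).normalize : Measure (Eucl d)) := by
    rw [hα, hπ, Measure.map_smul, Measure.map_add _ _ measurable_fst, Measure.map_smul,
      Measure.map_smul, Measure.map_map measurable_fst m1, Measure.map_map measurable_fst m2]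
    congr 3
    · exact Measure.map_id
    · change ν.map (fun _ => (x : Eucl d)) = _
      rw [Measure.map_const]
      simp [hν]
  have h2 : π.map Prod.snd = ν := by
    rw [hπ, Measure.map_smul, Measure.map_add _ _ measurable_snd, Measure.map_smul,
      Measure.map_smul, Measure.map_map measurable_snd m1, Measure.map_map measurable_snd m2]
    change c⁻¹ • (s • ν.map id + ε • ν.map id) = ν
    rw [Measure.map_id, ← add_smul, smul_smul, inv_mul_cancel₀ hc0, one_smul]
  have hcost : ∫⁻ p, edist p.1 p.2 ∂π ≤ (c⁻¹ * (ε * D) : ℝ≥0) := by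
    have e1 : ∫⁻ p, edist p.1 p.2 ∂(ν.map fun z => (z, z)) = 0 := by
      rw [lintegral_map (by fun_prop) m1]
      simp
    have e2 : ∫⁻ p, edist p.1 p.2 ∂(ν.map fun z => ((x : Eucl d), z)) ≤ D := by
      rw [lintegral_map (by fun_prop) m2]
      calc ∫⁻ z, edist (x : Eucl d) z ∂ν ≤ ∫⁻ _, D ∂ν := by
            refine lintegral_mono_ae ?_
            filter_upwards [show ∀ᵐ z ∂ν, z ∈ Ω from μ.normalize_compl] with z hz
            rw [hDdef, ENNReal.coe_toNNReal hD]
            exact Metric.edist_le_ediam_of_mem x.2 hz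
        _ = D := by simp [hν]
    rw [hπ, lintegral_smul_measure, lintegral_add_measure, lintegral_smul_measure,
      lintegral_smul_measure, e1, smul_zero, zero_add]
    simp only [ENNReal.smul_def, smul_eq_mul, ENNReal.coe_mul]
    gcongr
  have hw : (wass ((μ.addDirac hΩ.measurableSet x ε).normalize : Measure (Eucl d)) ν).toReal
      ≤ D / s * ε := by
    have h3 := wass_le_lintegral_coupling π
    rw [h1, h2] at h3
    have h4 := ENNReal.toReal_mono ENNReal.coe_ne_top (h3.trans hcost)
    refine h4.trans ?_
    rw [ENNReal.coe_toReal]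
    have h5 : (c : ℝ)⁻¹ ≤ (s : ℝ)⁻¹ := by
      gcongr
      exact le_self_add
    push_cast
    calc (c : ℝ)⁻¹ * (ε * D) ≤ (s : ℝ)⁻¹ * (ε * D) := by gcongr
      _ = D / s * ε := by ring
  have hm : |((μ.addDirac hΩ.measurableSet x ε).mass : ℝ) - μ.mass| = ε := by
    rw [mass_addDirac]
    push_cast
    rw [add_sub_cancel_left, abs_of_nonneg (NNReal.coe_nonneg ε)]
  rw [PosMeas.W1, hm, add_mul, one_mul]
  gcongr

/-- The image of a positive measure on `Ω` by a map with values in `Ω`. -/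
def mapOf (μ : PosMeas Ω) (r : Eucl d → Eucl d) (hr : Measurable r) (hrΩ : ∀ x, r x ∈ Ω)
    (hΩ : MeasurableSet Ω) : PosMeas Ω :=
  ⟨μ.1.map r, by
    constructor
    · intro h
      have h1 : (μ.1.map r) univ = 0 := by rw [h]; rfl
      rw [FiniteMeasure.map_apply _ hr MeasurableSet.univ, preimage_univ] at h1
      exact μ.mass_ne_zero h1
    · rw [FiniteMeasure.toMeasure_map, Measure.map_apply hr hΩ.compl]
      rw [show r ⁻¹' Ωᶜ = ∅ from eq_empty_of_forall_notMem fun x hx => hx (hrΩ x), measure_empty]⟩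

theorem toMeasure_mapOf (μ : PosMeas Ω) {r : Eucl d → Eucl d} (hr : Measurable r)
    (hrΩ : ∀ x, r x ∈ Ω) (hΩ : MeasurableSet Ω) :
    (μ.mapOf r hr hrΩ hΩ).toMeasure = μ.toMeasure.map r := rfl

theorem W1_mapOf_le (μ : PosMeas Ω) {r : Eucl d → Eucl d} (hr : Measurable r)
    (hrΩ : ∀ x, r x ∈ Ω) (hΩ : MeasurableSet Ω) {δ : ℝ} (hδ : 0 ≤ δ)
    (h : ∀ x ∈ Ω, dist (r x) x ≤ δ) : (μ.mapOf r hr hrΩ hΩ).W1 μ ≤ δ := by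
  have hm : (μ.mapOf r hr hrΩ hΩ).mass = μ.mass := by
    change (μ.1.map r) univ = μ.1 univ
    rw [FiniteMeasure.map_apply _ hr MeasurableSet.univ, preimage_univ]
  have hn : ((μ.mapOf r hr hrΩ hΩ).normalize : Measure (Eucl d))
      = (μ.normalize : Measure (Eucl d)).map r := by
    have h1 := (μ.mapOf r hr hrΩ hΩ).mass_smul_normalize
    rw [hm, toMeasure_mapOf, ← μ.mass_smul_normalize, Measure.map_smul] at h1
    have h2 := congrArg (fun m => μ.mass⁻¹ • m) h1
    simpa [smul_smul, inv_mul_cancel₀ μ.mass_ne_zero] using h2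
  rw [PosMeas.W1, hm, hn, sub_self, abs_zero, add_zero]
  refine ENNReal.toReal_le_of_le_ofReal hδ ?_
  have h1 := wass_map_le (μ.normalize : Measure (Eucl d)) hr measurable_id
  rw [Measure.map_id] at h1
  refine h1.trans ?_
  calc ∫⁻ x, edist (r x) x ∂(μ.normalize : Measure (Eucl d))
      ≤ ∫⁻ _, ENNReal.ofReal δ ∂(μ.normalize : Measure (Eucl d)) := by
        refine lintegral_mono_ae ?_
        filter_upwards [show ∀ᵐ z ∂(μ.normalize : Measure (Eucl d)), z ∈ Ω from
          μ.normalize_compl] with z hz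
        rw [edist_dist]
        exact ENNReal.ofReal_le_ofReal (h z hz)
    _ = _ := by simp

end PosMeas

theorem IsCompact.exists_discretization {d : ℕ} {Ω : Set (Eucl d)} (hΩ : IsCompact Ω)
    (hne : Ω.Nonempty) {δ : ℝ} (hδ : 0 < δ) : ∃ r : Eucl d → Eucl d, Measurable r ∧
      (range r).Finite ∧ (∀ x, r x ∈ Ω) ∧ ∀ x ∈ Ω, dist (r x) x ≤ δ := by
  obtain ⟨t, htΩ, htf, ht⟩ := hΩ.finite_cover_balls hδ
  have htne : t.Nonempty := by
    obtain ⟨x, hx⟩ := hne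
    obtain ⟨y, hy, -⟩ := mem_iUnion₂.1 (ht hx)
    exact ⟨y, hy⟩
  obtain ⟨e, he⟩ := htf.countable.exists_eq_range htne
  have hidx : ∀ y : t, ∃ k, e k = y := fun y =>
    (he ▸ subset_refl t : t ⊆ range e) y.2
  choose k hk using hidx
  have : Finite t := htf
  obtain ⟨N, hN⟩ := (finite_range k).bddAbove
  refine ⟨SimpleFunc.nearestPt e N, SimpleFunc.measurable _, SimpleFunc.finite_range _,
    fun x => htΩ ?_, fun x hx => ?_⟩
  · rw [he]
    exact ⟨_, rfl⟩
  · obtain ⟨y, hy, hxy⟩ := mem_iUnion₂.1 (ht hx)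
    have h1 := SimpleFunc.edist_nearestPt_le e x (hN ⟨⟨y, hy⟩, rfl⟩)
    rw [hk, edist_dist, edist_dist, ENNReal.ofReal_le_ofReal_iff dist_nonneg, dist_comm y] at h1
    exact h1.trans (le_of_lt hxy)

/-! ### Locally constant approximation of test functions -/

theorem ZeroAtInftyContinuousMap.exists_locConst_near_finset {d : ℕ} (ψ : C₀(Eucl d, ℝ))
    (hψ : ContDiff ℝ 1 ψ) (F : Finset (Eucl d)) : ∀ ε > 0, ∃ φ : C₀(Eucl d, ℝ),
      ContDiff ℝ 1 φ ∧ dist φ ψ ≤ ε ∧ ∀ y ∈ F, ∀ᶠ z in 𝓝 y, φ z = φ y := by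
  classical
  induction F using Finset.induction_on with
  | empty => exact fun ε hε => ⟨ψ, hψ, by simpa using hε.le, by simp⟩
  | insert y F hy ih =>
    intro ε hε
    obtain ⟨φ, hφ, hφψ, hφF⟩ := ih (ε / 2) (half_pos hε)
    obtain ⟨r₁, hr₁, h₁⟩ := Metric.continuousAt_iff.1 (φ.continuous.continuousAt (x := y)) (ε / 2)
      (half_pos hε)
    have hFy : (F : Set (Eucl d))ᶜ ∈ 𝓝 y := F.finite_toSet.isClosed.isOpen_compl.mem_nhds (by simpa)
    obtain ⟨r₂, hr₂, h₂⟩ := Metric.mem_nhds_iff.1 hFy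
    -- a bump function around `y` that is supported away from the points already treated
    let χ : ContDiffBump y := ⟨min r₁ r₂ / 4, min r₁ r₂ / 2, by positivity, by
      have : 0 < min r₁ r₂ := by positivity
      linarith⟩
    have hχr : χ.rOut = min r₁ r₂ / 2 := rfl
    have hr : 0 < min r₁ r₂ := by positivity
    have hcs : HasCompactSupport fun z => χ z * (φ z - φ y) := χ.hasCompactSupport.mul_right
    have hct : Continuous fun z => φ z - χ z * (φ z - φ y) := by
      have := χ.continuous
      have := φ.continuous
      fun_prop
    let φ' : C₀(Eucl d, ℝ) := ⟨⟨fun z => φ z - χ z * (φ z - φ y), hct⟩, by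
      simpa using φ.zero_at_infty'.sub hcs.is_zero_at_infty⟩
    have hφ' : ∀ z, φ' z = φ z - χ z * (φ z - φ y) := fun _ => rfl
    refine ⟨φ', hφ.sub (χ.contDiff.mul (hφ.sub contDiff_const)), ?_, fun y' hy' => ?_⟩
    · refine (dist_triangle _ φ _).trans ?_
      have : dist φ' φ ≤ ε / 2 := by
        rw [← ZeroAtInftyContinuousMap.dist_toBCF_eq_dist,
          BoundedContinuousFunction.dist_le (half_pos hε).le]
        intro z
        change dist (φ' z) (φ z) ≤ ε / 2
        rw [hφ', Real.dist_eq, sub_sub_cancel_left, abs_neg, abs_mul, abs_of_nonneg χ.nonneg]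
        by_cases hz : dist z y < χ.rOut
        · have h3 := h₁ (x := z) (by
            rw [hχr] at hz
            exact hz.trans_le ((half_le_self hr.le).trans (min_le_left _ _)))
          rw [Real.dist_eq] at h3
          calc χ z * |φ z - φ y| ≤ 1 * |φ z - φ y| := by gcongr; exact χ.le_one
            _ ≤ ε / 2 := by rw [one_mul]; exact h3.le
        · rw [χ.zero_of_le_dist (not_lt.1 hz), zero_mul]
          positivity
      linarith
    · rcases Finset.mem_insert.1 hy' with rfl | hy'F
      · have h3 : ∀ᶠ z in 𝓝 y', χ z = 1 := χ.eventuallyEq_one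
        filter_upwards [h3] with z hz
        rw [hφ', hφ', hz, sub_self, mul_zero]
        ring
      · have h3 : χ.rOut < dist y' y := by
          by_contra hle
          have h4 : y' ∈ Metric.ball y r₂ := by
            rw [Metric.mem_ball]
            rw [hχr] at hle
            have := min_le_right r₁ r₂
            linarith [not_lt.1 hle]
          exact h₂ h4 hy'F
        have h4 : ∀ᶠ z in 𝓝 y', χ.rOut < dist z y :=
          (isOpen_lt continuous_const (by fun_prop)).mem_nhds h3
        filter_upwards [hφF y' hy'F, h4] with z hz hz'
        rw [hφ', hφ', χ.zero_of_le_dist hz'.le, χ.zero_of_le_dist h3.le, hz]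

/-! ### The regular part of the derivative -/

section InContext

variable {d : ℕ} {Ω : Set (Eucl d)}

/-- A map on positive measures that is given by an in-context map is support preserving. -/
theorem supportPreserving_of_map {f : PosMeas Ω → PosMeas (univ : Set (Eucl d))}
    {G : PosMeas Ω → Eucl d → Eucl d} (hG : ∀ μ, Measurable (G μ))
    (hf : ∀ μ, (f μ).toMeasure = μ.toMeasure.map (G μ)) : SupportPreserving f := by
  intro n c x μ _ _ _ hμ
  refine ⟨fun i => G μ (x i), fun i j hij => by simp only [hij], ?_⟩
  rw [hf, hμ, ← Measure.mapₗ_apply_of_measurable (hG μ), map_sum]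
  refine Finset.sum_congr rfl fun i _ => ?_
  rw [Measure.mapₗ_apply_of_measurable (hG μ), Measure.map_smul, Measure.map_dirac' (hG μ)]

/-- The map `f` is the push-forward by an in-context map `G` that is continuous in `x`, and
Lipschitz in `(μ, x)` for `x` in `Ω`. -/
structure IsLipschitzInContext (f : PosMeas Ω → PosMeas (univ : Set (Eucl d)))
    (G : PosMeas Ω → Eucl d → Eucl d) (C : ℝ) : Prop where
  continuous : ∀ μ, Continuous (G μ)
  map_eq : ∀ μ, (f μ).toMeasure = μ.toMeasure.map (G μ)
  nonneg : 0 ≤ C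
  lipschitz : ∀ μ ν : PosMeas Ω, ∀ x ∈ Ω, ∀ y ∈ Ω, ‖G μ x - G ν y‖ ≤ C * (μ.W1 ν + ‖x - y‖)

variable {f : PosMeas Ω → PosMeas (univ : Set (Eucl d))} {G : PosMeas Ω → Eucl d → Eucl d} {C : ℝ}

theorem PosMeas.W1_nonneg (μ ν : PosMeas Ω) : 0 ≤ μ.W1 ν :=
  add_nonneg ENNReal.toReal_nonneg (abs_nonneg _)

theorem IsLipschitzInContext.isCompact_support (hfG : IsLipschitzInContext f G C)
    (hΩ : IsCompact Ω) (μ : PosMeas Ω) : IsCompact (f μ).toMeasure.support := by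
  have hK : IsCompact (G μ '' Ω) := hΩ.image (hfG.continuous μ)
  refine hK.of_isClosed_subset Measure.isClosed_support
    (Measure.support_subset_of_isClosed hK.isClosed ?_)
  rw [hfG.map_eq]
  refine (ae_map_iff (hfG.continuous μ).aemeasurable hK.measurableSet).2 ?_
  filter_upwards [μ.ae_mem] with x hx using mem_image_of_mem _ hx

/-- If `ψ` is locally constant near the support of `f μ`, then the displacement of the mass of `μ`
caused by a small added mass does not contribute to the difference quotient. -/
theorem IsLipschitzInContext.tendsto_diffQuot (hfG : IsLipschitzInContext f G C)
    (hΩ : IsCompact Ω) (μ : PosMeas Ω) (x : Ω) (ψ : C₀(Eucl d, ℝ))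
    (hψ : LocConstNearSupport ψ (f μ).toMeasure) :
    Tendsto (fun ε : ℝ≥0 => diffQuot hΩ.measurableSet f μ x ψ ε) (𝓝[>] 0) (𝓝 (ψ (G μ x))) := by
  obtain ⟨C', hC'⟩ := μ.exists_W1_addDirac_le hΩ x
  have hψc : Continuous ψ := map_continuous ψ
  -- `ψ` is constant on balls of a fixed radius `δ` around the points of the support
  obtain ⟨δ, hδ, hψδ⟩ : ∃ δ > 0, ∀ y ∈ (f μ).toMeasure.support, ∀ z, dist z y < δ → ψ z = ψ y := by
    have h : ∀ y : (f μ).toMeasure.support, ∃ r > 0, ∀ z ∈ Metric.ball (y : Eucl d) r,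
        ψ z = ψ y := fun y => Metric.eventually_nhds_iff_ball.1 (hψ y y.2)
    choose r hr hψr using h
    obtain ⟨δ, hδ, hcov⟩ := lebesgue_number_lemma_of_metric (hfG.isCompact_support hΩ μ)
      (c := fun y : (f μ).toMeasure.support => Metric.ball (y : Eucl d) (r y))
      (fun _ => Metric.isOpen_ball)
      (fun y hy => mem_iUnion.2 ⟨⟨y, hy⟩, Metric.mem_ball_self (hr _)⟩)
    refine ⟨δ, hδ, fun y hy z hz => ?_⟩
    obtain ⟨i, hi⟩ := hcov y hy
    rw [hψr i z (hi hz), hψr i y (hi (Metric.mem_ball_self hδ))]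
  set μ' : ℝ≥0 → PosMeas Ω := fun ε => μ.addDirac hΩ.measurableSet x ε with hμ'
  have hdist : ∀ ε, ∀ y ∈ Ω, ‖G (μ' ε) y - G μ y‖ ≤ C * (C' * ε) := fun ε y hy => by
    refine (hfG.lipschitz _ _ y hy y hy).trans ?_
    rw [sub_self, norm_zero, add_zero]
    exact mul_le_mul_of_nonneg_left (hC' ε) hfG.nonneg
  have hlim : Tendsto (fun ε : ℝ≥0 => C * (C' * (ε : ℝ))) (𝓝[>] 0) (𝓝 0) := by
    have : Continuous fun ε : ℝ≥0 => C * (C' * (ε : ℝ)) := by fun_prop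
    simpa using (this.tendsto 0).mono_left nhdsWithin_le_nhds
  have hG : Tendsto (fun ε => G (μ' ε) x) (𝓝[>] 0) (𝓝 (G μ x)) := by
    rw [tendsto_iff_norm_sub_tendsto_zero]
    exact squeeze_zero (fun _ => norm_nonneg _) (fun ε => hdist ε x x.2) hlim
  refine ((ψ.continuous.tendsto _).comp hG).congr' ?_
  filter_upwards [hlim.eventually (gt_mem_nhds hδ), self_mem_nhdsWithin] with ε hε hε0
  have hε0' : (0 : ℝ) < ε := hε0
  have e1 : ∫ y, ψ y ∂(f μ).toMeasure = ∫ y, ψ (G μ y) ∂μ.toMeasure := by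
    rw [hfG.map_eq, integral_map (hfG.continuous μ).aemeasurable
      hψc.aestronglyMeasurable]
  have e2 : ∫ y, ψ y ∂(f (μ' ε)).toMeasure
      = ∫ y, ψ (G (μ' ε) y) ∂μ.toMeasure + ε * ψ (G (μ' ε) x) := by
    have hc : Continuous fun y => ψ (G (μ' ε) y) := ψ.continuous.comp (hfG.continuous _)
    rw [hfG.map_eq, integral_map (hfG.continuous _).aemeasurable
      hψc.aestronglyMeasurable, hμ', PosMeas.toMeasure_addDirac, integral_add_measure
      (μ.integrable_of_continuous hΩ hc) ?_, integral_smul_nnreal_measure, integral_dirac]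
    · rfl
    · refine Integrable.smul_measure_nnreal ?_
      exact integrable_dirac (by simp)
  have e3 : ∫ y, ψ (G (μ' ε) y) ∂μ.toMeasure = ∫ y, ψ (G μ y) ∂μ.toMeasure := by
    have hsupp : ∀ᵐ y ∂μ.toMeasure, G μ y ∈ (f μ).toMeasure.support := by
      have : ∀ᵐ y ∂(f μ).toMeasure, y ∈ (f μ).toMeasure.support := Measure.support_mem_ae
      rw [hfG.map_eq μ] at this
      have h := ae_of_ae_map (hfG.continuous μ).aemeasurable this
      rwa [← hfG.map_eq μ] at h
    refine integral_congr_ae ?_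
    filter_upwards [hsupp, μ.ae_mem] with y hy hyΩ
    refine hψδ _ hy _ ?_
    rw [dist_eq_norm]
    exact (hdist ε y hyΩ).trans_lt hε
  rw [diffQuot, e2, e1, e3, add_sub_cancel_left, mul_div_cancel_left₀ _ hε0'.ne']
  rfl

/-- Admissible sequences exist: the measures are discretized, so that their images have finite
support, and the test functions are modified near the finitely many points of these supports. -/
theorem IsLipschitzInContext.exists_isAdmissible (hfG : IsLipschitzInContext f G C)
    (hΩ : IsCompact Ω) (hne : Ω.Nonempty) (μ : PosMeas Ω) (ψ : C₀(Eucl d, ℝ))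
    (hψ : ContDiff ℝ 1 ψ) : ∃ μs ψs, IsAdmissible f μ ψ μs ψs := by
  have key : ∀ k : ℕ, ∃ (ν : PosMeas Ω) (φ : C₀(Eucl d, ℝ)), ν.W1 μ ≤ 1 / ((k : ℝ) + 1) ∧
      ContDiff ℝ 1 φ ∧ dist φ ψ ≤ 1 / ((k : ℝ) + 1) ∧
      LocConstNearSupport φ (f ν).toMeasure := by
    intro k
    have hk : (0 : ℝ) < 1 / ((k : ℝ) + 1) := by positivity
    obtain ⟨r, hr, hrf, hrΩ, hrδ⟩ := hΩ.exists_discretization hne hk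
    set ν := μ.mapOf r hr hrΩ hΩ.measurableSet with hν
    set F := (hrf.image (G ν)).toFinset with hF
    obtain ⟨φ, hφ, hφψ, hφF⟩ := ψ.exists_locConst_near_finset hψ F _ hk
    refine ⟨ν, φ, μ.W1_mapOf_le hr hrΩ hΩ.measurableSet hk.le hrδ, hφ, hφψ, fun y hy => ?_⟩
    have hsub : (f ν).toMeasure.support ⊆ (F : Set (Eucl d)) := by
      refine Measure.support_subset_of_isClosed F.finite_toSet.isClosed ?_
      rw [hfG.map_eq, hν, PosMeas.toMeasure_mapOf, Measure.map_map (hfG.continuous _).measurable hr]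
      refine (ae_map_iff ((hfG.continuous _).measurable.comp hr).aemeasurable
        F.finite_toSet.measurableSet).2 (Eventually.of_forall fun x => ?_)
      exact (Finite.mem_toFinset _).2 (mem_image_of_mem _ (mem_range_self x))
    exact hφF y (hsub hy)
  choose μs ψs h1 h2 h3 h4 using key
  exact ⟨μs, ψs, h2, h4,
    squeeze_zero (fun _ => PosMeas.W1_nonneg _ _) h1 tendsto_one_div_add_atTop_nhds_zero_nat,
    squeeze_zero (fun _ => dist_nonneg) h3 tendsto_one_div_add_atTop_nhds_zero_nat⟩

theorem ZeroAtInftyContinuousMap.abs_apply_sub_le_dist (φ ψ : C₀(Eucl d, ℝ)) (x : Eucl d) :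
    |φ x - ψ x| ≤ dist φ ψ := by
  rw [← Real.dist_eq, ← ZeroAtInftyContinuousMap.dist_toBCF_eq_dist]
  exact BoundedContinuousFunction.dist_coe_le_dist (f := φ.toBCF) (g := ψ.toBCF) x

/-- The regular part of the derivative is `ψ (G(μ, x))`. -/
theorem IsLipschitzInContext.hasRegularPart (hfG : IsLipschitzInContext f G C)
    (hΩ : IsCompact Ω) (μ : PosMeas Ω) (x : Ω) (ψ : C₀(Eucl d, ℝ)) (hψ : ContDiff ℝ 1 ψ) :
    HasRegularPart hΩ.measurableSet f μ x ψ (ψ (G μ x)) := by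
  refine ⟨hfG.exists_isAdmissible hΩ ⟨x, x.2⟩ μ ψ hψ, fun μs ψs h => ?_⟩
  refine ⟨fun k => ψs k (G (μs k) x),
    fun k => hfG.tendsto_diffQuot hΩ (μs k) x (ψs k) (h.locConst k), ?_⟩
  have hG : Tendsto (fun k => G (μs k) x) atTop (𝓝 (G μ x)) := by
    rw [tendsto_iff_norm_sub_tendsto_zero]
    refine squeeze_zero (fun _ => norm_nonneg _)
      (fun k => hfG.lipschitz (μs k) μ x x.2 x x.2) ?_
    simpa using h.tendsto_measure.const_mul C
  have h1 : Tendsto (fun k => ψs k (G (μs k) x) - ψ (G (μs k) x)) atTop (𝓝 0) :=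
    squeeze_zero_norm (fun k => (ψs k).abs_apply_sub_le_dist ψ _) h.tendsto_fun
  simpa using h1.add ((ψ.continuous.tendsto _).comp hG)

theorem IsLipschitzInContext.uniformRegularPart (hfG : IsLipschitzInContext f G C)
    (hΩ : IsCompact Ω) (ρ η : ℝ≥0) : UniformRegularPart hΩ.measurableSet f ρ η := by
  refine ⟨fun p => p.ψ (G p.μ p.x), fun p => hfG.hasRegularPart hΩ p.μ p.x p.ψ p.contDiff,
    fun ε hε => ?_⟩
  have hC := hfG.nonneg
  have hpos : 0 < 1 + η * C := by positivity
  refine ⟨ε / (1 + η * C), by positivity, fun p q hpq => ?_⟩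
  rw [lt_div_iff₀ hpos] at hpq
  refine lt_of_le_of_lt ?_ hpq
  have h1 := p.ψ.abs_apply_sub_le_dist q.ψ (G p.μ p.x)
  have h2 := q.lipschitz.dist_le_mul (G p.μ p.x) (G q.μ q.x)
  have h3 := hfG.lipschitz p.μ q.μ p.x p.x.2 q.x q.x.2
  rw [Real.dist_eq, dist_eq_norm] at h2
  rw [← dist_eq_norm (p.x : Eucl d), ← Subtype.dist_eq] at h3
  have h4 := abs_sub_le (p.ψ (G p.μ p.x)) (q.ψ (G p.μ p.x)) (q.ψ (G q.μ q.x))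
  have h5 : (η : ℝ) * ‖G p.μ p.x - G q.μ q.x‖ ≤ η * (C * (p.μ.W1 q.μ + dist p.x q.x)) := by
    gcongr
  have h6 := p.μ.W1_nonneg q.μ
  have h7 : 0 ≤ η * C * dist p.ψ q.ψ := by positivity
  rw [Triplet.D]
  have h8 : (p.μ.W1 q.μ + dist p.x q.x + dist p.ψ q.ψ) * (1 + η * C)
      = dist p.ψ q.ψ + η * (C * (p.μ.W1 q.μ + dist p.x q.x)) + η * C * dist p.ψ q.ψ
        + (p.μ.W1 q.μ + dist p.x q.x) := by ring
  have h9 : 0 ≤ dist p.x q.x := dist_nonneg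
  linarith

end InContext

theorem IsUniformField.isLipschitzInContext {d : ℕ} {V : ProbCpt d → ℝ → Eucl d → Eucl d} {T : ℝ}
    {L K : ℝ≥0} (hV : IsUniformField V T L K) (hT : 0 ≤ T) {Ω : Set (Eucl d)}
    (hΩ : IsCompact Ω) : IsLipschitzInContext (homExtend hΩ (solutionMap V T))
      (fun μ x => flowMap V T (μ.toProbCpt hΩ) x) (Real.exp ((L + 2 * K + 1) * T)) where
  continuous μ := (hV.lipschitzWith_characteristic hT (μ.toProbCpt hΩ) ⟨hT, le_rfl⟩).continuous
  map_eq μ := by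
    have h := hV.toMeasure_vlasovSolution hT (μ.toProbCpt hΩ) ⟨hT, le_rfl⟩
    change μ.mass • (vlasovSolution V T (μ.toProbCpt hΩ) T).toMeasure = _
    rw [h, ← μ.mass_smul_normalize, Measure.map_smul]
    rfl
  nonneg := (Real.exp_pos _).le
  lipschitz μ ν x _ y _ := by
    refine (hV.norm_flowMap_sub_le hT _ _ x y).trans ?_
    gcongr
    exact PosMeas.W1_toProbCpt_le hΩ μ ν

end

theorem proposition4 {d : ℕ} (V : ProbCpt d → ℝ → Eucl d → Eucl d) (hV : IsVelocityField V)
    (T : ℝ) (hT : 0 ≤ T) :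
    -- the solution and its characteristics exist and are unique
    (∀ μ₀ : ProbCpt d, ∃ μ, IsVlasovSolution V T μ₀ μ ∧
      ∀ μ', IsVlasovSolution V T μ₀ μ' → EqOn μ' μ (Icc 0 T)) ∧
    (∀ (μ₀ : ProbCpt d) (x : Eucl d), ∃ γ, IsCharacteristic V T μ₀ x γ ∧
      ∀ γ', IsCharacteristic V T μ₀ x γ' → EqOn γ' γ (Icc 0 T)) ∧
    ∃ C : ℝ, ∀ (Ω : Set (Eucl d)) (hΩ : IsCompact Ω),
      -- the solution map is given by the flow map
      IsGivenByInContext (homExtend hΩ (solutionMap V T))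
        (fun μ x => flowMap V T (μ.toProbCpt hΩ) x) ∧
      -- the flow map is Lipschitz
      (∀ (μ ν : PosMeas Ω), ∀ x ∈ Ω, ∀ y ∈ Ω,
        ‖flowMap V T (μ.toProbCpt hΩ) x - flowMap V T (ν.toProbCpt hΩ) y‖
          ≤ C * (μ.W1 ν + ‖x - y‖)) ∧
      -- conditions (B1) and (B2)
      SupportPreserving (homExtend hΩ (solutionMap V T)) ∧
      ∀ ρ η : ℝ≥0, 0 < ρ → 0 < η →
        UniformRegularPart hΩ.measurableSet (homExtend hΩ (solutionMap V T)) ρ η := by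
  obtain ⟨L, K, hU⟩ := hV.exists_isUniformField T
  refine ⟨fun μ₀ => ?_, fun μ₀ x => ?_, Real.exp ((L + 2 * K + 1) * T), fun Ω hΩ => ?_⟩
  · exact ⟨_, hU.isVlasovSolution_vlasovSolution hT μ₀, fun μ' hμ' =>
      hU.eqOn_of_isVlasovSolution hT hμ' (hU.isVlasovSolution_vlasovSolution hT μ₀)⟩
  · exact ⟨_, hU.isCharacteristic_characteristic hT μ₀ x, fun γ' hγ' =>
      hU.eqOn_of_isCharacteristic hγ' (hU.isCharacteristic_characteristic hT μ₀ x)⟩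
  · have h := hU.isLipschitzInContext hT hΩ
    exact ⟨fun μ => ⟨(h.continuous μ).aemeasurable, h.map_eq μ⟩, h.lipschitz,
      supportPreserving_of_map (fun μ => (h.continuous μ).measurable) h.map_eq,
      fun ρ η _ _ => h.uniformRegularPart hΩ ρ η⟩
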